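/- A globular set $X$ consists of sets $X_n$ ($n\ge 0$) and maps $s,t:X_{n+1}\to X_n$ with $ss=st$ and $ts=tt$; two $n$-cells are parallel if $n=0$ or if they have the same source and the same target. Let $U:\omega\mathrm{Cat}\to\mathrm{Glob}$ be the forgetful functor from (small) strict $\omega$-categories and $\omega$-functors to globular sets. A polygraph $P$ consists of sets $P_n$ of $n$-generators and an $\omega$-category $P^*$ freely generated by them dimension by dimension, with inclusions $\iota_n:P_n\hookrightarrow P^*_n$: the map $\iota_0$ is a bijection, every $(n+1)$-generator has parallel source and target in $P^*_n$, and the $(n+1)$-category of cells of dimension $\le n+1$ of $P^*$ is the free extension of the $n$-category of cells of dimension $\le n$ of $P^*$ by the $(n+1)$-generators. A morphism of polygraphs $P\to Q$ is a family of maps $P_n\to Q_n$ compatible with sources and targets, i.e. extending to a (necessarily unique) $\omega$-functor $P^*\to Q^*$. Let $\mathrm{Pol}$ be the category of polygraphs. Let $W:\omega\mathrm{Cat}\to\mathrm{Pol}$ be the functor which sends an $\omega$-category $C$ to the polygraph $W(C)$ defined, together with an $\omega$-functor $\varepsilon^C:W(C)^*\to C$, by induction on the dimension: $W(C)_0=C_0$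 and $\varepsilon^C_0$ is the identity; for $n>0$, the $n$-generators of $W(C)$ are the triples $(z,x,y)$ where $x,y$ are parallel cells of $W(C)^*_{n-1}$ and $z\in C_n$ has source $\varepsilon^C(x)$ and target $\varepsilon^C(y)$; the source and the target of the generator $(z,x,y)$ are $x$ and $y$, and $\varepsilon^C(z,x,y)=z$. An $\omega$-functor $f:C\to D$ induces $W(f)$ by $c\mapsto f(c)$ on $0$-generators and $(z,x,y)\mapsto(f(z),W(f)^*(x),W(f)^*(y))$ in positive dimensions. Let $G:\mathrm{Pol}\to\mathrm{Glob}$ be the functor which sends a polygraph $P$ to the globular set $X$ with $X_n\subseteq P_n$ defined by induction: $X_0=P_0$, and for $n>0$, $X_n$ is the set of those $a\in P_n$ whose source and target belong to $\iota_{n-1}(X_{n-1})$, the source and target maps of $X$ being those induced by the source and target in $P^*$; on morphisms, $G$ is given by restriction. Then there is a natural isomorphism $\phi:G\circ W\to U$. -/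

import Mathlib

open CategoryTheory

universe u

/-! ### Globular sets -/

/-- Iterating maps `A (n + 1) → A n` downwards, from `A n` to `A j` for `j ≤ n`. -/
def iterDown {A : ℕ → Type u} (d : ∀ n, A (n + 1) → A n) {j n : ℕ} (h : j ≤ n) : A n → A j :=
  Nat.leRec (motive := fun m _ => A m → A j) (fun x => x) (fun m _ f x => f (d m x)) h

/-- Iterating maps `A n → A (n + 1)` upwards, from `A j` to `A n` for `j ≤ n`. -/
def iterUp {A : ℕ → Type u} (e : ∀ n, A n → A (n + 1)) {j n : ℕ} (h : j ≤ n) : A j → A n :=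
  Nat.leRec (motive := fun m _ => A j → A m) (fun x => x) (fun m _ f x => e m (f x)) h

/-- A (strict) globular set. -/
structure GlobularSet : Type (u + 1) where
  cell : ℕ → Type u
  src : ∀ {n : ℕ}, cell (n + 1) → cell n
  tgt : ∀ {n : ℕ}, cell (n + 1) → cell n
  src_src : ∀ {n : ℕ} (x : cell (n + 2)), src (src x) = src (tgt x)
  tgt_src : ∀ {n : ℕ} (x : cell (n + 2)), tgt (src x) = tgt (tgt x)

namespace GlobularSet

/-- The `j`-dimensional source of an `n`-cell, `j ≤ n`. -/
def srcTo (X : GlobularSet.{u}) {j n : ℕ} (h : j ≤ n) : X.cell n → X.cell j :=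
  iterDown (A := X.cell) (fun _ => X.src) h

/-- The `j`-dimensional target of an `n`-cell, `j ≤ n`. -/
def tgtTo (X : GlobularSet.{u}) {j n : ℕ} (h : j ≤ n) : X.cell n → X.cell j :=
  iterDown (A := X.cell) (fun _ => X.tgt) h

/-- Two `n`-cells are parallel if `n = 0`, or if they have the same source and the same target. -/
def Parallel (X : GlobularSet.{u}) : ∀ {n : ℕ}, X.cell n → X.cell n → Prop
  | 0, _, _ => True
  | _ + 1, x, y => X.src x = X.src y ∧ X.tgt x = X.tgt y

/-- Morphisms of globular sets. -/
@[ext]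
structure Hom (X Y : GlobularSet.{u}) : Type u where
  map : ∀ {n : ℕ}, X.cell n → Y.cell n
  map_src : ∀ {n : ℕ} (x : X.cell (n + 1)), map (X.src x) = Y.src (map x)
  map_tgt : ∀ {n : ℕ} (x : X.cell (n + 1)), map (X.tgt x) = Y.tgt (map x)

instance : Category.{u} GlobularSet.{u} where
  Hom := Hom
  id X := ⟨fun x => x, fun _ => rfl, fun _ => rfl⟩
  comp f g := ⟨fun x => g.map (f.map x), fun x => by rw [f.map_src, g.map_src],
    fun x => by rw [f.map_tgt, g.map_tgt]⟩

end GlobularSet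

/-! ### Strict ω-categories -/

/-- A strict ω-category: a globular set with identities and, for `j < n`, a composition
`x *_j y` of `n`-cells defined when the `j`-target of `x` is the `j`-source of `y`, subject to the
usual laws. In the laws, the composability proofs of composites are quantified over; they all
follow from the composability of the given cells. -/
structure OmegaCat : Type (u + 1) extends GlobularSet.{u} where
  idn : ∀ {n : ℕ}, cell n → cell (n + 1)
  comp : ∀ {n : ℕ} (j : ℕ) (hj : j < n) (x y : cell n),
    toGlobularSet.tgtTo hj.le x = toGlobularSet.srcTo hj.le y → cell n
  src_idn : ∀ {n : ℕ} (x : cell n), src (idn x) = x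
  tgt_idn : ∀ {n : ℕ} (x : cell n), tgt (idn x) = x
  src_comp_top : ∀ {n : ℕ} (x y : cell (n + 1)) (h),
    src (comp n n.lt_succ_self x y h) = src x
  tgt_comp_top : ∀ {n : ℕ} (x y : cell (n + 1)) (h),
    tgt (comp n n.lt_succ_self x y h) = tgt y
  src_comp : ∀ {n j : ℕ} (hj : j < n) (x y : cell (n + 1)) (h h'),
    src (comp j (hj.trans n.lt_succ_self) x y h) = comp j hj (src x) (src y) h'
  tgt_comp : ∀ {n j : ℕ} (hj : j < n) (x y : cell (n + 1)) (h h'),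
    tgt (comp j (hj.trans n.lt_succ_self) x y h) = comp j hj (tgt x) (tgt y) h'
  comp_assoc : ∀ {n j : ℕ} (hj : j < n) (x y z : cell n) (h₁ h₂ h₃ h₄),
    comp j hj (comp j hj x y h₁) z h₂ = comp j hj x (comp j hj y z h₃) h₄
  id_comp : ∀ {n j : ℕ} (hj : j < n) (x : cell n) (h),
    comp j hj (iterUp (A := cell) (fun _ => idn) hj.le (toGlobularSet.srcTo hj.le x)) x h = x
  comp_id : ∀ {n j : ℕ} (hj : j < n) (x : cell n) (h),
    comp j hj x (iterUp (A := cell) (fun _ => idn) hj.le (toGlobularSet.tgtTo hj.le x)) h = x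
  exchange : ∀ {n i j : ℕ} (hij : i < j) (hj : j < n) (x y z w : cell n) (h₁ h₂ h₃ h₄ h₅ h₆),
    comp i (hij.trans hj) (comp j hj x y h₁) (comp j hj z w h₂) h₃ =
      comp j hj (comp i (hij.trans hj) x z h₄) (comp i (hij.trans hj) y w h₅) h₆
  idn_comp : ∀ {n j : ℕ} (hj : j < n) (x y : cell n) (h h'),
    idn (comp j hj x y h) = comp j (hj.trans n.lt_succ_self) (idn x) (idn y) h'

namespace OmegaCat

/-- ω-functors: globular maps that preserve identities and compositions. -/
@[ext]
structure Hom (C D : OmegaCat.{u}) : Type u where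
  map : ∀ {n : ℕ}, C.cell n → D.cell n
  map_src : ∀ {n : ℕ} (x : C.cell (n + 1)), map (C.src x) = D.src (map x)
  map_tgt : ∀ {n : ℕ} (x : C.cell (n + 1)), map (C.tgt x) = D.tgt (map x)
  map_idn : ∀ {n : ℕ} (x : C.cell n), map (C.idn x) = D.idn (map x)
  map_comp : ∀ {n j : ℕ} (hj : j < n) (x y : C.cell n) (h h'),
    map (C.comp j hj x y h) = D.comp j hj (map x) (map y) h'

/-- `n`-functors between the `n`-categories of cells of dimension at most `n`. -/
@[ext]
structure TruncHom (n : ℕ) (C D : OmegaCat.{u}) : Type u where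
  map : ∀ (k : ℕ), k ≤ n → C.cell k → D.cell k
  map_src : ∀ (k : ℕ) (hk : k + 1 ≤ n) (x : C.cell (k + 1)),
    map k (k.le_succ.trans hk) (C.src x) = D.src (map (k + 1) hk x)
  map_tgt : ∀ (k : ℕ) (hk : k + 1 ≤ n) (x : C.cell (k + 1)),
    map k (k.le_succ.trans hk) (C.tgt x) = D.tgt (map (k + 1) hk x)
  map_idn : ∀ (k : ℕ) (hk : k + 1 ≤ n) (x : C.cell k),
    map (k + 1) hk (C.idn x) = D.idn (map k (k.le_succ.trans hk) x)
  map_comp : ∀ (k : ℕ) (hk : k ≤ n) (j : ℕ) (hj : j < k) (x y : C.cell k) (h h'),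
    map k hk (C.comp j hj x y h) = D.comp j hj (map k hk x) (map k hk y) h'

/-- The restriction of an `(n + 1)`-functor to cells of dimension at most `n`. -/
def TruncHom.restrict {n : ℕ} {C D : OmegaCat.{u}} (F : TruncHom (n + 1) C D) :
    TruncHom n C D where
  map k hk := F.map k (hk.trans n.le_succ)
  map_src k hk := F.map_src k (hk.trans n.le_succ)
  map_tgt k hk := F.map_tgt k (hk.trans n.le_succ)
  map_idn k hk := F.map_idn k (hk.trans n.le_succ)
  map_comp k hk := F.map_comp k (hk.trans n.le_succ)

end OmegaCat

/-! ### Elementary facts on iterated sources and targets -/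

section Iter

variable {A : ℕ → Type u}

theorem iterDown_self (d : ∀ n, A (n + 1) → A n) {n : ℕ} (h : n ≤ n) (x : A n) :
    iterDown d h x = x := by
  unfold iterDown; rw [Nat.leRec_self]

theorem iterDown_succ (d : ∀ n, A (n + 1) → A n) {j n : ℕ} (h : j ≤ n) (h' : j ≤ n + 1)
    (x : A (n + 1)) : iterDown d h' x = iterDown d h (d n x) := by
  unfold iterDown; rw [Nat.leRec_succ (h1 := h)]

theorem iterUp_self (e : ∀ n, A n → A (n + 1)) {n : ℕ} (h : n ≤ n) (x : A n) :
    iterUp e h x = x := by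
  unfold iterUp; rw [Nat.leRec_self]

theorem iterUp_succ (e : ∀ n, A n → A (n + 1)) {j n : ℕ} (h : j ≤ n) (h' : j ≤ n + 1)
    (x : A j) : iterUp e h' x = e n (iterUp e h x) := by
  unfold iterUp; rw [Nat.leRec_succ (h1 := h)]

theorem iterDown_trans (d : ∀ n, A (n + 1) → A n) {i j n : ℕ} (hij : i ≤ j) (hj : j ≤ n)
    (x : A n) : iterDown d hij (iterDown d hj x) = iterDown d (hij.trans hj) x := by
  induction n, hj using Nat.le_induction with
  | base => rw [iterDown_self]
  | succ n hj ih => rw [iterDown_succ d hj, ih, iterDown_succ d (hij.trans hj)]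

theorem iterDown_up (d : ∀ n, A (n + 1) → A n) (e : ∀ n, A n → A (n + 1))
    (hde : ∀ n x, d n (e n x) = x) {i j n : ℕ} (hij : i ≤ j) (hj : j ≤ n)
    (x : A i) : iterDown d hj (iterUp e (hij.trans hj) x) = iterUp e hij x := by
  induction n, hj using Nat.le_induction with
  | base => rw [iterDown_self]
  | succ n hj ih => rw [iterDown_succ d hj, iterUp_succ e (hij.trans hj), hde, ih]

theorem iterDown_comm {B : ℕ → Type u} (d : ∀ n, A (n + 1) → A n) (d' : ∀ n, B (n + 1) → B n)
    (f : ∀ n, A n → B n) (hf : ∀ n x, f n (d n x) = d' n (f (n + 1) x)) {j n : ℕ} (h : j ≤ n)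
    (x : A n) : f j (iterDown d h x) = iterDown d' h (f n x) := by
  induction n, h using Nat.le_induction with
  | base => rw [iterDown_self, iterDown_self]
  | succ n hj ih => rw [iterDown_succ d hj, iterDown_succ d' hj, ih, hf]

theorem iterUp_comm {B : ℕ → Type u} (d : ∀ n, A n → A (n + 1)) (d' : ∀ n, B n → B (n + 1))
    (f : ∀ n, A n → B n) (hf : ∀ n x, f (n + 1) (d n x) = d' n (f n x)) {j n : ℕ} (h : j ≤ n)
    (x : A j) : f n (iterUp d h x) = iterUp d' h (f j x) := by
  induction n, h using Nat.le_induction with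
  | base => rw [iterUp_self, iterUp_self]
  | succ n hj ih => rw [iterUp_succ d hj, iterUp_succ d' hj, hf, ih]

end Iter

namespace GlobularSet

variable (X : GlobularSet.{u})

/-- Source (`false`) and target (`true`) treated uniformly. -/
def bd (ε : Bool) {n : ℕ} : X.cell (n + 1) → X.cell n :=
  match ε with
  | false => X.src
  | true => X.tgt

/-- Iterated source (`false`) and target (`true`). -/
def bdTo (ε : Bool) {j n : ℕ} (h : j ≤ n) : X.cell n → X.cell j :=
  iterDown (A := X.cell) (fun _ => X.bd ε) h

theorem bdTo_false {j n : ℕ} (h : j ≤ n) : X.bdTo false h = X.srcTo h := rfl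

theorem bdTo_true {j n : ℕ} (h : j ≤ n) : X.bdTo true h = X.tgtTo h := rfl

theorem bd_bd (ε δ : Bool) {n : ℕ} (x : X.cell (n + 2)) :
    X.bd ε (X.bd δ x) = X.bd ε (X.bd ε x) := by
  cases ε <;> cases δ
  · rfl
  · exact (X.src_src x).symm
  · exact X.tgt_src x
  · rfl

theorem bdTo_self (ε : Bool) {n : ℕ} (h : n ≤ n) (x : X.cell n) : X.bdTo ε h x = x :=
  iterDown_self _ h x

theorem bdTo_succ (ε : Bool) {j n : ℕ} (h : j ≤ n) (h' : j ≤ n + 1) (x : X.cell (n + 1)) :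
    X.bdTo ε h' x = X.bdTo ε h (X.bd ε x) :=
  iterDown_succ _ h h' x

theorem bdTo_bd (ε δ : Bool) {j n : ℕ} (h : j < n) (h' : j ≤ n + 1) (x : X.cell (n + 1)) :
    X.bdTo ε h.le (X.bd δ x) = X.bdTo ε h' x := by
  obtain ⟨n, rfl⟩ : ∃ m, n = m + 1 := ⟨n - 1, by omega⟩
  rw [X.bdTo_succ ε h.le h', X.bdTo_succ ε (Nat.lt_succ_iff.mp h),
    X.bdTo_succ ε (Nat.lt_succ_iff.mp h), bd_bd]

theorem bdTo_bdTo (ε δ : Bool) {i j n : ℕ} (hij : i < j) (hj : j ≤ n) (x : X.cell n) :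
    X.bdTo ε hij.le (X.bdTo δ hj x) = X.bdTo ε (hij.le.trans hj) x := by
  induction n, hj using Nat.le_induction with
  | base => rw [bdTo_self]
  | succ n hj ih => rw [X.bdTo_succ δ hj, ih, bdTo_bd _ _ _ (hij.trans_le hj)]

theorem bdTo_bdTo_same (ε : Bool) {i j n : ℕ} (hij : i ≤ j) (hj : j ≤ n) (x : X.cell n) :
    X.bdTo ε hij (X.bdTo ε hj x) = X.bdTo ε (hij.trans hj) x :=
  iterDown_trans _ hij hj x

end GlobularSet

namespace OmegaCat

variable (C : OmegaCat.{u})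

/-- Iterated identities. -/
def idTo {j n : ℕ} (h : j ≤ n) : C.cell j → C.cell n := iterUp (A := C.cell) (fun _ => C.idn) h

theorem bd_idn (ε : Bool) {n : ℕ} (x : C.cell n) : C.bd ε (C.idn x) = x := by
  cases ε
  · exact C.src_idn x
  · exact C.tgt_idn x

theorem comp_congr {n j : ℕ} (hj : j < n) {x x' y y' : C.cell n} (hx : x = x') (hy : y = y')
    (h h') : C.comp j hj x y h = C.comp j hj x' y' h' := by
  subst hx; subst hy; rfl

theorem bd_composable (ε : Bool) {n j : ℕ} (hj : j < n) {x y : C.cell (n + 1)}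
    (h : C.tgtTo (hj.trans n.lt_succ_self).le x = C.srcTo (hj.trans n.lt_succ_self).le y) :
    C.tgtTo hj.le (C.bd ε x) = C.srcTo hj.le (C.bd ε y) := by
  have h1 := C.bdTo_bd true ε hj (hj.trans n.lt_succ_self).le x
  have h2 := C.bdTo_bd false ε hj (hj.trans n.lt_succ_self).le y
  exact h1.trans (h.trans h2.symm)

theorem bdTo_composable (ε : Bool) {n j k : ℕ} (hkj : k < j) (hj : j ≤ n) {x y : C.cell n}
    (h : C.tgtTo (hkj.le.trans hj) x = C.srcTo (hkj.le.trans hj) y) :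
    C.tgtTo hkj.le (C.bdTo ε hj x) = C.srcTo hkj.le (C.bdTo ε hj y) := by
  have h1 := C.bdTo_bdTo true ε hkj hj x
  have h2 := C.bdTo_bdTo false ε hkj hj y
  exact h1.trans (h.trans h2.symm)

theorem bdTo_comp_high (ε : Bool) {n j k : ℕ} (hk : k < n) (hkj : k < j) (hj : j ≤ n)
    (x y : C.cell n) (h h') :
    C.bdTo ε hj (C.comp k hk x y h) = C.comp k hkj (C.bdTo ε hj x) (C.bdTo ε hj y) h' := by
  induction n, hj using Nat.le_induction with
  | base =>
    rw [C.bdTo_self]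
    exact C.comp_congr _ (C.bdTo_self ..).symm (C.bdTo_self ..).symm _ _
  | succ n hj ih =>
    rw [C.bdTo_succ ε hj]
    have hkn : k < n := hkj.trans_le hj
    have e : C.bd ε (C.comp k hk x y h) =
        C.comp k hkn (C.bd ε x) (C.bd ε y) (C.bd_composable ε hkn h) := by
      cases ε
      · exact C.src_comp ..
      · exact C.tgt_comp ..
    rw [e, ih hkn]
    · exact C.comp_congr _ (C.bdTo_succ ..).symm (C.bdTo_succ ..).symm _ _
    · exact C.bdTo_composable ε hkj hj (C.bd_composable ε hkn h)

theorem bdTo_comp_low (ε : Bool) {n j k : ℕ} (hk : k < n) (hjk : j ≤ k)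
    (x y : C.cell n) (h) :
    C.bdTo ε (hjk.trans hk.le) (C.comp k hk x y h) =
      C.bdTo ε (hjk.trans hk.le) (cond ε y x) := by
  rw [← C.bdTo_bdTo_same ε (hjk.trans k.le_succ) hk, C.bdTo_comp_high ε hk k.lt_succ_self hk x y h
    (C.bdTo_composable ε k.lt_succ_self hk h), C.bdTo_succ ε hjk]
  rw [← C.bdTo_bdTo_same ε (hjk.trans k.le_succ) hk (cond ε y x), C.bdTo_succ ε hjk]
  congr 1
  cases ε
  · exact C.src_comp_top ..
  · exact C.tgt_comp_top ..

theorem bdTo_idTo (ε : Bool) {i j n : ℕ} (hij : i ≤ j) (hj : j ≤ n) (x : C.cell i) :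
    C.bdTo ε hj (C.idTo (hij.trans hj) x) = C.idTo hij x :=
  iterDown_up (A := C.cell) _ _ (fun _ x => C.bd_idn ε x) hij hj x

theorem idTo_self {n : ℕ} (h : n ≤ n) (x : C.cell n) : C.idTo h x = x := iterUp_self (A := C.cell) _ h x

theorem idTo_succ {j n : ℕ} (h : j ≤ n) (h' : j ≤ n + 1) (x : C.cell j) :
    C.idTo h' x = C.idn (C.idTo h x) := iterUp_succ (A := C.cell) _ h h' x

namespace Hom

variable {C} {D : OmegaCat.{u}}

theorem map_bd (f : Hom C D) (ε : Bool) {n : ℕ} (x : C.cell (n + 1)) :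
    f.map (C.bd ε x) = D.bd ε (f.map x) := by
  cases ε
  · exact f.map_src x
  · exact f.map_tgt x

theorem map_bdTo (f : Hom C D) (ε : Bool) {j n : ℕ} (h : j ≤ n) (x : C.cell n) :
    f.map (C.bdTo ε h x) = D.bdTo ε h (f.map x) :=
  iterDown_comm (A := C.cell) (B := D.cell) _ _ (fun _ => f.map) (fun _ => f.map_bd ε) h x

theorem map_composable (f : Hom C D) {j n : ℕ} (hj : j ≤ n) {x y : C.cell n}
    (h : C.tgtTo hj x = C.srcTo hj y) : D.tgtTo hj (f.map x) = D.srcTo hj (f.map y) :=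
  (f.map_bdTo true hj x).symm.trans ((congrArg f.map h).trans (f.map_bdTo false hj y))

end Hom

instance : Category.{u} OmegaCat.{u} where
  Hom := Hom
  id C := ⟨fun x => x, fun _ => rfl, fun _ => rfl, fun _ => rfl, fun _ _ _ _ _ => rfl⟩
  comp {_ _ E} f g := ⟨fun x => g.map (f.map x), fun x => by rw [f.map_src, g.map_src],
    fun x => by rw [f.map_tgt, g.map_tgt], fun x => by rw [f.map_idn, g.map_idn],
    fun hj x y h h' => by
      rw [f.map_comp hj x y h (f.map_composable hj.le h), g.map_comp]⟩

end OmegaCat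

/-- The forgetful functor from ω-categories to globular sets. -/
def forgetU : OmegaCat.{u} ⥤ GlobularSet.{u} where
  obj C := C.toGlobularSet
  map f := ⟨f.map, f.map_src, f.map_tgt⟩

/-! ### Polygraphs -/

/-- A polygraph: sets `gen n` of `n`-generators together with the ω-category `free` which they
generate freely, dimension by dimension. The `0`-cells of `free` are the `0`-generators; an
`(n + 1)`-generator has a source and a target which are parallel `n`-cells of `free`; and the
`(n + 1)`-category of cells of dimension at most `n + 1` of `free` is freely generated by the
`n`-category of cells of dimension at most `n` and the `(n + 1)`-generators. -/
structure Polygraph : Type (u + 1) where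
  free : OmegaCat.{u}
  gen : ℕ → Type u
  /-- the canonical inclusion of generators into the cells -/
  inc : ∀ {n : ℕ}, gen n → free.cell n
  inc_injective : ∀ n : ℕ, Function.Injective (inc : gen n → free.cell n)
  inc_zero_surjective : Function.Surjective (inc : gen 0 → free.cell 0)
  universal : ∀ (n : ℕ) (D : OmegaCat.{u}) (F : OmegaCat.TruncHom n free D)
    (g : gen (n + 1) → D.cell (n + 1)),
    (∀ a, D.src (g a) = F.map n le_rfl (free.src (inc a))) →
    (∀ a, D.tgt (g a) = F.map n le_rfl (free.tgt (inc a))) →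
    ∃! G : OmegaCat.TruncHom (n + 1) free D,
      G.restrict = F ∧ ∀ a, G.map (n + 1) le_rfl (inc a) = g a

namespace Polygraph

/-- Morphisms of polygraphs: maps between generators compatible with sources and targets, that is,
maps between generators that extend to an ω-functor between the free ω-categories. By freeness the
extension is unique. -/
@[ext]
structure Hom (P Q : Polygraph.{u}) : Type u where
  free : P.free ⟶ Q.free
  gen : ∀ {n : ℕ}, P.gen n → Q.gen n
  free_inc : ∀ {n : ℕ} (a : P.gen n), free.map (P.inc a) = Q.inc (gen a)

instance : Category.{u} Polygraph.{u} where
  Hom := Hom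
  id P := ⟨𝟙 P.free, fun a => a, fun _ => rfl⟩
  comp f g := ⟨f.free ≫ g.free, fun a => g.gen (f.gen a), fun a => by
    rw [← g.free_inc, ← f.free_inc]; rfl⟩

/-- The hereditarily globular generators: all generators in dimension `0`, and in dimension
`n + 1` those whose source and target are (inclusions of) hereditarily globular generators. -/
def IsGlob (P : Polygraph.{u}) : ∀ {n : ℕ}, P.gen n → Prop
  | 0, _ => True
  | _ + 1, a => (∃ b, P.IsGlob b ∧ P.inc b = P.free.src (P.inc a)) ∧
      (∃ b, P.IsGlob b ∧ P.inc b = P.free.tgt (P.inc a))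

/-- The source of a hereditarily globular generator, as a generator. -/
noncomputable def globSrc (P : Polygraph.{u}) {n : ℕ} (a : {a : P.gen (n + 1) // P.IsGlob a}) :
    {a : P.gen n // P.IsGlob a} :=
  ⟨a.2.1.choose, a.2.1.choose_spec.1⟩

/-- The target of a hereditarily globular generator, as a generator. -/
noncomputable def globTgt (P : Polygraph.{u}) {n : ℕ} (a : {a : P.gen (n + 1) // P.IsGlob a}) :
    {a : P.gen n // P.IsGlob a} :=
  ⟨a.2.2.choose, a.2.2.choose_spec.1⟩

theorem inc_globSrc (P : Polygraph.{u}) {n : ℕ} (a : {a : P.gen (n + 1) // P.IsGlob a}) :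
    P.inc (P.globSrc a).1 = P.free.src (P.inc a.1) :=
  a.2.1.choose_spec.2

theorem inc_globTgt (P : Polygraph.{u}) {n : ℕ} (a : {a : P.gen (n + 1) // P.IsGlob a}) :
    P.inc (P.globTgt a).1 = P.free.tgt (P.inc a.1) :=
  a.2.2.choose_spec.2

theorem glob_ext (P : Polygraph.{u}) {n : ℕ} {a b : {a : P.gen n // P.IsGlob a}}
    (h : P.inc a.1 = P.inc b.1) : a = b :=
  Subtype.ext (P.inc_injective n h)

theorem Hom.isGlob {P Q : Polygraph.{u}} (f : Hom P Q) {n : ℕ} (a : P.gen n) (h : P.IsGlob a) :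
    Q.IsGlob (f.gen a) := by
  induction n with
  | zero => trivial
  | succ n ih =>
    obtain ⟨⟨b, hb, hb'⟩, c, hc, hc'⟩ := h
    refine ⟨⟨f.gen b, ih b hb, ?_⟩, f.gen c, ih c hc, ?_⟩
    · rw [← f.free_inc, ← f.free_inc, hb']; exact f.free.map_src _
    · rw [← f.free_inc, ← f.free_inc, hc']; exact f.free.map_tgt _

/-- The globular set of hereditarily globular generators. -/
noncomputable def glob (P : Polygraph.{u}) : GlobularSet.{u} where
  cell n := {a : P.gen n // P.IsGlob a}
  src := P.globSrc
  tgt := P.globTgt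
  src_src x := P.glob_ext (by simp only [inc_globSrc, inc_globTgt, P.free.src_src])
  tgt_src x := P.glob_ext (by simp only [inc_globSrc, inc_globTgt, P.free.tgt_src])

/-- The action of a morphism of polygraphs on hereditarily globular generators. -/
noncomputable def Hom.glob {P Q : Polygraph.{u}} (f : Hom P Q) :
    GlobularSet.Hom P.glob Q.glob where
  map a := ⟨f.gen a.1, f.isGlob a.1 a.2⟩
  map_src a := Q.glob_ext (by
    refine Eq.trans ?_ (Q.inc_globSrc _).symm
    refine (f.free_inc _).symm.trans ?_
    refine (congrArg f.free.map (P.inc_globSrc a)).trans ?_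
    exact (f.free.map_src _).trans (congrArg _ (f.free_inc _)))
  map_tgt a := Q.glob_ext (by
    refine Eq.trans ?_ (Q.inc_globTgt _).symm
    refine (f.free_inc _).symm.trans ?_
    refine (congrArg f.free.map (P.inc_globTgt a)).trans ?_
    exact (f.free.map_tgt _).trans (congrArg _ (f.free_inc _)))

end Polygraph

/-- The functor from polygraphs to globular sets which keeps only the hereditarily globular
generators. -/
noncomputable def globG : Polygraph.{u} ⥤ GlobularSet.{u} where
  obj P := P.glob
  map f := Polygraph.Hom.glob f

/-! ### The polygraph of an ω-category

For an ω-category `C`, the polygraph `W(C)` has the `0`-cells of `C` as `0`-generators, and as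
`(n + 1)`-generators the triples `(z, x, y)` where `x`, `y` are parallel `n`-cells of the free
ω-category on the generators of lower dimension and `z` is an `(n + 1)`-cell of `C` from the value
of `x` to the value of `y`. The cells of the free ω-category are the classes of formal expressions
in these generators modulo the congruence generated by the axioms of ω-categories. -/

/-- Formal expressions for the cells of the free ω-category on `W(C)` (not yet well-formed). -/
inductive Raw (C : OmegaCat.{u}) : ℕ → Type u
  | ob (c : C.cell 0) : Raw C 0
  | gen {n : ℕ} (z : C.cell (n + 1)) (x y : Raw C n) : Raw C (n + 1)
  | idn {n : ℕ} (x : Raw C n) : Raw C (n + 1)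
  | comp {n : ℕ} (j : ℕ) (x y : Raw C n) : Raw C n

namespace Raw

variable {C : OmegaCat.{u}}

/-- Formal source (`false`) and target (`true`) of an expression. -/
def bd (ε : Bool) : ∀ {n : ℕ}, Raw C n → Raw C (n - 1)
  | _, .ob c => .ob c
  | _, .gen _ x y => cond ε y x
  | _, .idn x => x
  | n, .comp j x y =>
    if j + 1 = n then cond ε (bd ε y) (bd ε x) else .comp j (bd ε x) (bd ε y)

/-- Formal iterated source (`false`) and target (`true`). -/
def bdTo (ε : Bool) {j n : ℕ} (h : j ≤ n) : Raw C n → Raw C j :=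
  iterDown (A := Raw C) (fun n (x : Raw C (n + 1)) => bd ε x) h

/-- Formal iterated identities. -/
def idTo {j n : ℕ} (h : j ≤ n) : Raw C j → Raw C n :=
  iterUp (A := Raw C) (fun _ => Raw.idn) h

open Classical in
/-- The value in `C` of an expression; it is meaningful on well-formed expressions. -/
noncomputable def eval : ∀ {n : ℕ}, Raw C n → C.cell n
  | _, .ob c => c
  | _, .gen z _ _ => z
  | _, .idn x => C.idn (eval x)
  | n, .comp j x y =>
    if h : ∃ hj : j < n, C.tgtTo hj.le (eval x) = C.srcTo hj.le (eval y) then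
      C.comp j h.1 (eval x) (eval y) h.2
    else eval x

/-- The congruence on expressions generated by the axioms of ω-categories. It is a partial
equivalence relation: an expression is well-formed when it is related to itself. -/
inductive Rel : ∀ {n : ℕ}, Raw C n → Raw C n → Prop
  | symm {n : ℕ} {x y : Raw C n} : Rel x y → Rel y x
  | trans {n : ℕ} {x y z : Raw C n} : Rel x y → Rel y z → Rel x z
  | ob (c : C.cell 0) : Rel (.ob c) (.ob c)
  | gen {n : ℕ} {z : C.cell (n + 1)} {x x' y y' : Raw C n} : Rel x x' → Rel y y' →
      (∀ (ε : Bool) (j : ℕ) (h : j < n), Rel (bdTo ε h.le x) (bdTo ε h.le y)) →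
      C.src z = eval x → C.tgt z = eval y → Rel (.gen z x y) (.gen z x' y')
  | idn {n : ℕ} {x x' : Raw C n} : Rel x x' → Rel (.idn x) (.idn x')
  | comp {n j : ℕ} (hj : j < n) {x x' y y' : Raw C n} : Rel x x' → Rel y y' →
      Rel (bdTo true hj.le x) (bdTo false hj.le y) → Rel (.comp j x y) (.comp j x' y')
  | assoc {n j : ℕ} (hj : j < n) {x y z : Raw C n} : Rel x x → Rel y y → Rel z z →
      Rel (bdTo true hj.le x) (bdTo false hj.le y) →
      Rel (bdTo true hj.le y) (bdTo false hj.le z) →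
      Rel (.comp j (.comp j x y) z) (.comp j x (.comp j y z))
  | id_comp {n j : ℕ} (hj : j < n) {x : Raw C n} : Rel x x →
      Rel (.comp j (idTo hj.le (bdTo false hj.le x)) x) x
  | comp_id {n j : ℕ} (hj : j < n) {x : Raw C n} : Rel x x →
      Rel (.comp j x (idTo hj.le (bdTo true hj.le x))) x
  | exchange {n i j : ℕ} (hij : i < j) (hj : j < n) {x y z w : Raw C n} :
      Rel x x → Rel y y → Rel z z → Rel w w →
      Rel (bdTo true hj.le x) (bdTo false hj.le y) →
      Rel (bdTo true hj.le z) (bdTo false hj.le w) →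
      Rel (bdTo true (hij.trans hj).le x) (bdTo false (hij.trans hj).le z) →
      Rel (.comp i (.comp j x y) (.comp j z w)) (.comp j (.comp i x z) (.comp i y w))
  | idn_comp {n j : ℕ} (hj : j < n) {x y : Raw C n} : Rel x x → Rel y y →
      Rel (bdTo true hj.le x) (bdTo false hj.le y) →
      Rel (.idn (.comp j x y)) (.comp j (.idn x) (.idn y))

theorem Rel.left {n : ℕ} {x y : Raw C n} (h : Rel x y) : Rel x x := h.trans h.symm

theorem Rel.right {n : ℕ} {x y : Raw C n} (h : Rel x y) : Rel y y := h.symm.trans h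

theorem bdTo_self (ε : Bool) {n : ℕ} (h : n ≤ n) (x : Raw C n) : bdTo ε h x = x :=
  iterDown_self (A := Raw C) _ h x

theorem bdTo_succ (ε : Bool) {j n : ℕ} (h : j ≤ n) (h' : j ≤ n + 1) (x : Raw C (n + 1)) :
    bdTo ε h' x = bdTo ε h (bd ε x : Raw C n) :=
  iterDown_succ (A := Raw C) _ h h' x

theorem bdTo_bdTo_same (ε : Bool) {i j n : ℕ} (hij : i ≤ j) (hj : j ≤ n) (x : Raw C n) :
    bdTo ε hij (bdTo ε hj x) = bdTo ε (hij.trans hj) x :=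
  iterDown_trans (A := Raw C) _ hij hj x

theorem idTo_self {n : ℕ} (h : n ≤ n) (x : Raw C n) : idTo h x = x :=
  iterUp_self (A := Raw C) _ h x

theorem idTo_succ {j n : ℕ} (h : j ≤ n) (h' : j ≤ n + 1) (x : Raw C j) :
    idTo h' x = .idn (idTo h x) := iterUp_succ (A := Raw C) _ h h' x

theorem bdTo_idTo (ε : Bool) {i j n : ℕ} (hij : i ≤ j) (hj : j ≤ n) (x : Raw C i) :
    bdTo ε hj (idTo (hij.trans hj) x) = idTo hij x :=
  iterDown_up (A := Raw C) _ _ (fun _ _ => rfl) hij hj x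

theorem bdTo_gen (ε : Bool) {j n : ℕ} (h : j ≤ n) (h' : j ≤ n + 1) (z : C.cell (n + 1))
    (x y : Raw C n) : bdTo ε h' (.gen z x y) = bdTo ε h (cond ε y x) := bdTo_succ ε h h' _

theorem bdTo_idn (ε : Bool) {j n : ℕ} (h : j ≤ n) (h' : j ≤ n + 1)
    (x : Raw C n) : bdTo ε h' (.idn x) = bdTo ε h x := bdTo_succ ε h h' _

theorem bdTo_comp_high (ε : Bool) {n j k : ℕ} (hkj : k < j) (hj : j ≤ n) (x y : Raw C n) :
    bdTo ε hj (.comp k x y) = .comp k (bdTo ε hj x) (bdTo ε hj y) := by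
  induction n, hj using Nat.le_induction with
  | base => rw [bdTo_self, bdTo_self, bdTo_self]
  | succ n hj ih =>
    rw [bdTo_succ ε hj, bdTo_succ ε hj, bdTo_succ ε hj]
    have : k + 1 ≠ n + 1 := by omega
    simp only [bd, this, if_false]
    exact ih _ _

theorem bdTo_comp_low (ε : Bool) {n j k : ℕ} (hk : k < n) (hjk : j ≤ k) (h : j ≤ n)
    (x y : Raw C n) :
    bdTo ε h (.comp k x y) = bdTo ε h (cond ε y x) := by
  rw [← bdTo_bdTo_same ε (hjk.trans k.le_succ) hk, bdTo_comp_high ε k.lt_succ_self hk,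
    bdTo_succ ε hjk, ← bdTo_bdTo_same ε (hjk.trans k.le_succ) hk, bdTo_succ ε hjk]
  congr 1
  cases ε <;> simp [bd]

theorem Rel.idTo {j n : ℕ} (h : j ≤ n) {x y : Raw C j} (r : Rel x y) :
    Rel (idTo h x) (idTo h y) := by
  induction n, h using Nat.le_induction with
  | base => rwa [idTo_self, idTo_self]
  | succ n h ih => rw [idTo_succ h, idTo_succ h]; exact ih.idn

/-- The globular identities up to the congruence. -/
def Glob {n : ℕ} (x : Raw C n) : Prop :=
  ∀ (ε δ : Bool) (i j : ℕ) (hi : i < j) (h : j ≤ n),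
    Rel (bdTo ε hi.le (bdTo δ h x)) (bdTo ε (hi.le.trans h) x)

/-- The boundaries of `x` and `y` are congruent. -/
def BdRel {n : ℕ} (x y : Raw C n) : Prop :=
  ∀ (ε : Bool) (j : ℕ) (h : j ≤ n), Rel (bdTo ε h x) (bdTo ε h y)

/-- Formal composability, together with the equality of the lower boundaries. -/
def Cmp {n k : ℕ} (hk : k ≤ n) (x y : Raw C n) : Prop :=
  Rel (bdTo true hk x) (bdTo false hk y) ∧
    ∀ (ε : Bool) (i : ℕ) (h : i < k), Rel (bdTo ε (h.le.trans hk) x) (bdTo ε (h.le.trans hk) y)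

theorem Cmp.of {n k : ℕ} {hk : k ≤ n} {x y : Raw C n} (gx : Glob x) (gy : Glob y)
    (r : Rel (bdTo true hk x) (bdTo false hk y))
    (b : BdRel (bdTo true hk x) (bdTo false hk y)) : Cmp hk x y :=
  ⟨r, fun ε i h => (gx ε true i k h hk).symm.trans ((b ε i h.le).trans (gy ε false i k h hk))⟩

theorem Cmp.bdTo {n k j : ℕ} (hkj : k < j) (hj : j ≤ n) {x y : Raw C n} (gx : Glob x)
    (gy : Glob y) (c : Rel (bdTo true (hkj.le.trans hj) x) (bdTo false (hkj.le.trans hj) y))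
    (δ δ' : Bool) :
    Rel (Raw.bdTo true hkj.le (Raw.bdTo δ hj x)) (Raw.bdTo false hkj.le (Raw.bdTo δ' hj y)) :=
  (gx true δ k j hkj hj).trans (c.trans (gy false δ' k j hkj hj).symm)

theorem bdRel_comp {n k : ℕ} (hk : k < n) {x x' y y' : Raw C n} (gx : Glob x) (gy : Glob y)
    (bx : BdRel x x') (bY : BdRel y y')
    (c : Rel (bdTo true hk.le x) (bdTo false hk.le y)) :
    BdRel (.comp k x y) (.comp k x' y') := by
  intro ε j h
  rcases le_or_gt j k with hjk | hkj
  · rw [bdTo_comp_low ε hk hjk, bdTo_comp_low ε hk hjk]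
    cases ε
    · exact bx false j h
    · exact bY true j h
  · rw [bdTo_comp_high ε hkj, bdTo_comp_high ε hkj]
    exact .comp hkj (bx ε j h) (bY ε j h) (Cmp.bdTo hkj h gx gy c ε ε)

theorem glob_comp {n k : ℕ} (hk : k < n) {x y : Raw C n} (gx : Glob x) (gy : Glob y)
    (c : Cmp hk.le x y) : Glob (.comp k x y) := by
  intro ε δ i j hi h
  rcases le_or_gt j k with hjk | hkj
  · rw [bdTo_comp_low δ hk hjk, bdTo_comp_low ε hk (hi.le.trans hjk)]
    have h1 := c.2 ε i (hi.trans_le hjk)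
    cases ε <;> cases δ
    · exact gx _ _ i j hi h
    · exact (gy _ _ i j hi h).trans h1.symm
    · exact (gx _ _ i j hi h).trans h1
    · exact gy _ _ i j hi h
  · rw [bdTo_comp_high δ hkj]
    rcases le_or_gt i k with hik | hki
    · rw [bdTo_comp_low ε hkj hik, bdTo_comp_low ε hk hik]
      cases ε
      · exact gx _ _ i j hi h
      · exact gy _ _ i j hi h
    · rw [bdTo_comp_high ε hki, bdTo_comp_high ε hki]
      exact .symm (.comp hki (gx _ _ i j hi h).symm (gy _ _ i j hi h).symm
        (Cmp.bdTo hki (hi.le.trans h) gx gy c.1 ε ε))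

theorem glob_idn {n : ℕ} {x : Raw C n} (gx : Glob x) (bx : BdRel x x) : Glob (.idn x) := by
  intro ε δ i j hi h
  rcases h.lt_or_eq with h | rfl
  · rw [bdTo_idn δ (Nat.lt_succ_iff.mp h), bdTo_idn ε (hi.le.trans (Nat.lt_succ_iff.mp h))]
    exact gx _ _ i j hi _
  · rw [bdTo_self, bdTo_idn ε (Nat.lt_succ_iff.mp hi)]
    exact bx _ _ _

theorem bdRel_idn {n : ℕ} {x y : Raw C n} (r : Rel x y) (b : BdRel x y) :
    BdRel (.idn x) (.idn y) := by
  intro ε j h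
  rcases h.lt_or_eq with h | rfl
  · rw [bdTo_idn ε (Nat.lt_succ_iff.mp h), bdTo_idn ε (Nat.lt_succ_iff.mp h)]
    exact b _ _ _
  · rw [bdTo_self, bdTo_self]
    exact r.idn

theorem bdRel_idTo {k n : ℕ} (hk : k ≤ n) {x y : Raw C k} (r : Rel x y) (b : BdRel x y) :
    BdRel (idTo hk x) (idTo hk y) := by
  induction n, hk using Nat.le_induction with
  | base => rwa [idTo_self, idTo_self]
  | succ n hk ih => rw [idTo_succ hk, idTo_succ hk]; exact bdRel_idn (r.idTo hk) ih

theorem glob_idTo {k n : ℕ} (hk : k ≤ n) {x : Raw C k} (r : Rel x x) (gx : Glob x)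
    (bx : BdRel x x) : Glob (idTo hk x) := by
  induction n, hk using Nat.le_induction with
  | base => rwa [idTo_self]
  | succ n hk ih => rw [idTo_succ hk]; exact glob_idn ih (bdRel_idTo hk r bx)

theorem glob_gen {n : ℕ} {z : C.cell (n + 1)} {x y : Raw C n}
    (gx : Glob x) (gy : Glob y) (bx : BdRel x x) (bY : BdRel y y)
    (p : ∀ (ε : Bool) (j : ℕ) (h : j < n), Rel (bdTo ε h.le x) (bdTo ε h.le y)) :
    Glob (.gen z x y) := by
  intro ε δ i j hi h
  rcases h.lt_or_eq with h | rfl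
  · have hj := Nat.lt_succ_iff.mp h
    rw [bdTo_gen δ hj, bdTo_gen ε (hi.le.trans hj)]
    have h1 := p ε i (hi.trans_le hj)
    cases ε <;> cases δ
    · exact gx _ _ i j hi _
    · exact (gy _ _ i j hi _).trans h1.symm
    · exact (gx _ _ i j hi _).trans h1
    · exact gy _ _ i j hi _
  · rw [bdTo_self, bdTo_gen ε (Nat.lt_succ_iff.mp hi)]
    cases ε
    · exact bx _ _ _
    · exact bY _ _ _

theorem bdRel_gen {n : ℕ} {z : C.cell (n + 1)} {x y x' y' : Raw C n}
    (r : Rel (.gen z x y) (.gen z x' y')) (bx : BdRel x x') (bY : BdRel y y') :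
    BdRel (.gen z x y) (.gen z x' y') := by
  intro ε j h
  rcases h.lt_or_eq with h | rfl
  · rw [bdTo_gen ε (Nat.lt_succ_iff.mp h), bdTo_gen ε (Nat.lt_succ_iff.mp h)]
    cases ε
    · exact bx _ _ _
    · exact bY _ _ _
  · rw [bdTo_self, bdTo_self]
    exact r

theorem BdRel.symm {n : ℕ} {x y : Raw C n} (h : BdRel x y) : BdRel y x :=
  fun ε j hj => (h ε j hj).symm

theorem BdRel.trans {n : ℕ} {x y z : Raw C n} (h : BdRel x y) (h' : BdRel y z) : BdRel x z :=
  fun ε j hj => (h ε j hj).trans (h' ε j hj)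

theorem Cmp.comp_left {n k : ℕ} (hk : k < n) {x y z : Raw C n}
    (h : Cmp hk.le x y) (h' : Cmp hk.le y z) : Cmp hk.le (.comp k x y) z := by
  refine ⟨?_, fun ε i hi => ?_⟩
  · rw [bdTo_comp_low true hk le_rfl]; exact h'.1
  · rw [bdTo_comp_low ε hk hi.le]
    cases ε
    · exact (h.2 _ _ hi).trans (h'.2 _ _ hi)
    · exact h'.2 _ _ hi

theorem Cmp.comp_right {n k : ℕ} (hk : k < n) {x y z : Raw C n}
    (h : Cmp hk.le x y) (h' : Cmp hk.le y z) : Cmp hk.le x (.comp k y z) := by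
  refine ⟨?_, fun ε i hi => ?_⟩
  · rw [bdTo_comp_low false hk le_rfl]; exact h.1
  · rw [bdTo_comp_low ε hk hi.le]
    cases ε
    · exact h.2 _ _ hi
    · exact (h.2 _ _ hi).trans (h'.2 _ _ hi)

theorem bdRel_of_rel {n : ℕ} {x y : Raw C n} (r : Rel x y) : BdRel x y ∧ Glob x ∧ Glob y := by
  suffices H : ∀ N n : ℕ, n ≤ N → ∀ {x y : Raw C n}, Rel x y → BdRel x y ∧ Glob x ∧ Glob y from
    H n n le_rfl r
  clear r x y n
  intro N
  induction N using Nat.strong_induction_on with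
  | _ N IH =>
  intro n hn x y r
  induction r with
  | symm r ih => obtain ⟨a, b, c⟩ := ih hn; exact ⟨a.symm, c, b⟩
  | trans r r' ih ih' =>
    obtain ⟨a, b, c⟩ := ih hn
    obtain ⟨a', b', c'⟩ := ih' hn
    exact ⟨a.trans a', b, c'⟩
  | ob c =>
    have hg : Glob (Raw.ob c) := fun ε δ i j hi h => absurd (hi.trans_le h) (Nat.not_lt_zero _)
    refine ⟨fun ε j h => ?_, hg, hg⟩
    obtain rfl := Nat.le_zero.mp h
    rw [bdTo_self]; exact .ob c
  | @gen n z x x' y y' rx ry p hs ht ihx ihy ihp =>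
    have hn' : n ≤ N := n.le_succ.trans hn
    obtain ⟨bx, gx, gx'⟩ := ihx hn'
    obtain ⟨bY, gy, gy'⟩ := ihy hn'
    have R : Rel (.gen z x y) (.gen z x' y') := .gen rx ry p hs ht
    refine ⟨bdRel_gen R bx bY,
      glob_gen gx gy (bx.trans bx.symm) (bY.trans bY.symm) p,
      glob_gen gx' gy' (bx.symm.trans bx) (bY.symm.trans bY) fun ε j h =>
        (bx ε j h.le).symm.trans ((p ε j h).trans (bY ε j h.le))⟩
  | @idn n x y r ih =>
    have hn' : n ≤ N := n.le_succ.trans hn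
    obtain ⟨bx, gx, gx'⟩ := ih hn'
    exact ⟨bdRel_idn r bx, glob_idn gx (bx.trans bx.symm), glob_idn gx' (bx.symm.trans bx)⟩
  | @comp n k hk x x' y y' rx ry rc ihx ihy ihc =>
    obtain ⟨bx, gx, gx'⟩ := ihx hn
    obtain ⟨bY, gy, gy'⟩ := ihy hn
    have c : Cmp hk.le x y := .of gx gy rc (ihc (hk.le.trans hn)).1
    have c' : Cmp hk.le x' y' := ⟨(bx true k hk.le).symm.trans (c.1.trans (bY false k hk.le)),
      fun ε i h => (bx ε i _).symm.trans ((c.2 ε i h).trans (bY ε i _))⟩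
    exact ⟨bdRel_comp hk gx gy bx bY rc, glob_comp hk gx gy c, glob_comp hk gx' gy' c'⟩
  | @assoc n k hk x y z rx ry rz rc rc' ihx ihy ihz ihc ihc' =>
    obtain ⟨bx, gx, -⟩ := ihx hn
    obtain ⟨bY, gy, -⟩ := ihy hn
    obtain ⟨bz, gz, -⟩ := ihz hn
    have c : Cmp hk.le x y := .of gx gy rc (ihc (hk.le.trans hn)).1
    have c' : Cmp hk.le y z := .of gy gz rc' (ihc' (hk.le.trans hn)).1
    refine ⟨fun ε j h => ?_, glob_comp hk (glob_comp hk gx gy c) gz (.comp_left hk c c'),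
      glob_comp hk gx (glob_comp hk gy gz c') (.comp_right hk c c')⟩
    rcases le_or_gt j k with hjk | hkj
    · rw [bdTo_comp_low ε hk hjk, bdTo_comp_low ε hk hjk]
      cases ε
      · simp only [cond_false, bdTo_comp_low false hk hjk]; exact bx _ _ _
      · simp only [cond_true, bdTo_comp_low true hk hjk]; exact bz _ _ _
    · simp only [bdTo_comp_high ε hkj]
      exact .assoc hkj (bx _ _ _) (bY _ _ _) (bz _ _ _) (Cmp.bdTo hkj h gx gy rc _ _)
        (Cmp.bdTo hkj h gy gz rc' _ _)
  | @id_comp n k hk x rx ihx =>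
    obtain ⟨bx, gx, -⟩ := ihx hn
    have rs := bx false k hk.le
    obtain ⟨bs, gs, -⟩ := IH k (hk.trans_le hn) k le_rfl rs
    have gi := glob_idTo hk.le rs gs bs
    have c : Cmp hk.le (idTo hk.le (bdTo false hk.le x)) x := by
      refine ⟨?_, fun ε i h => ?_⟩
      · rw [bdTo_idTo true le_rfl hk.le, idTo_self]; exact rs
      · have h1 := bdTo_bdTo_same ε h.le hk.le (idTo hk.le (bdTo false hk.le x))
        rw [bdTo_idTo ε le_rfl hk.le, idTo_self] at h1
        rw [← h1]; exact gx _ _ _ _ h _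
    refine ⟨fun ε j h => ?_, glob_comp hk gi gx c, gx⟩
    rcases le_or_gt j k with hjk | hkj
    · rw [bdTo_comp_low ε hk hjk]
      cases ε
      · have h1 := bdTo_bdTo_same false hjk hk.le (idTo hk.le (bdTo false hk.le x))
        rw [bdTo_idTo false le_rfl hk.le, idTo_self, bdTo_bdTo_same] at h1
        rw [cond_false, ← h1]; exact bx _ _ _
      · exact bx _ _ _
    · rw [bdTo_comp_high ε hkj, bdTo_idTo ε hkj.le h]
      have h2 : Rel (bdTo false hkj.le (bdTo ε h x)) (bdTo false hk.le x) := gx _ _ _ _ hkj h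
      refine .trans ?_ (.id_comp hkj (bx ε j h))
      refine .comp hkj (h2.symm.idTo hkj.le) (bx ε j h) ?_
      rw [bdTo_idTo true le_rfl hkj.le, idTo_self]
      exact h2.symm
  | @comp_id n k hk x rx ihx =>
    obtain ⟨bx, gx, -⟩ := ihx hn
    have rs := bx true k hk.le
    obtain ⟨bs, gs, -⟩ := IH k (hk.trans_le hn) k le_rfl rs
    have gi := glob_idTo hk.le rs gs bs
    have c : Cmp hk.le x (idTo hk.le (bdTo true hk.le x)) := by
      refine ⟨?_, fun ε i h => ?_⟩
      · rw [bdTo_idTo false le_rfl hk.le, idTo_self]; exact rs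
      · have h1 := bdTo_bdTo_same ε h.le hk.le (idTo hk.le (bdTo true hk.le x))
        rw [bdTo_idTo ε le_rfl hk.le, idTo_self] at h1
        rw [← h1]; exact (gx _ _ _ _ h _).symm
    refine ⟨fun ε j h => ?_, glob_comp hk gx gi c, gx⟩
    rcases le_or_gt j k with hjk | hkj
    · rw [bdTo_comp_low ε hk hjk]
      cases ε
      · exact bx _ _ _
      · have h1 := bdTo_bdTo_same true hjk hk.le (idTo hk.le (bdTo true hk.le x))
        rw [bdTo_idTo true le_rfl hk.le, idTo_self, bdTo_bdTo_same] at h1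
        rw [cond_true, ← h1]; exact bx _ _ _
    · rw [bdTo_comp_high ε hkj, bdTo_idTo ε hkj.le h]
      have h2 : Rel (bdTo true hkj.le (bdTo ε h x)) (bdTo true hk.le x) := gx _ _ _ _ hkj h
      refine .trans ?_ (.comp_id hkj (bx ε j h))
      refine .comp hkj (bx ε j h) (h2.symm.idTo hkj.le) ?_
      rw [bdTo_idTo false le_rfl hkj.le, idTo_self]
      exact h2
  | @exchange n i k hik hk x y z w rx ry rz rw_ c₁ c₂ c₃ ihx ihy ihz ihw ih₁ ih₂ ih₃ =>
    have hi := hik.trans hk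
    obtain ⟨bx, gx, -⟩ := ihx hn
    obtain ⟨bY, gy, -⟩ := ihy hn
    obtain ⟨bz, gz, -⟩ := ihz hn
    obtain ⟨bw, gw, -⟩ := ihw hn
    have C₁ : Cmp hk.le x y := .of gx gy c₁ (ih₁ (hk.le.trans hn)).1
    have C₂ : Cmp hk.le z w := .of gz gw c₂ (ih₂ (hk.le.trans hn)).1
    have C₃ : Cmp hi.le x z := .of gx gz c₃ (ih₃ (hi.le.trans hn)).1
    have C₄ : Cmp hi.le y w := ⟨(C₁.2 _ _ hik).symm.trans (c₃.trans (C₂.2 _ _ hik)),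
      fun ε l h => (C₁.2 ε l (h.trans hik)).symm.trans
        ((C₃.2 ε l h).trans (C₂.2 ε l (h.trans hik)))⟩
    have C₅ : Cmp hi.le (.comp k x y) (.comp k z w) := by
      refine ⟨?_, fun ε l h => ?_⟩
      · rw [bdTo_comp_low _ hk hik.le, bdTo_comp_low _ hk hik.le]
        exact (C₁.2 _ _ hik).symm.trans c₃
      · rw [bdTo_comp_low _ hk (h.trans hik).le, bdTo_comp_low _ hk (h.trans hik).le]
        cases ε
        · exact C₃.2 _ _ h
        · exact C₄.2 _ _ h
    have C₆ : Cmp hk.le (.comp i x z) (.comp i y w) := by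
      refine ⟨?_, fun ε l h => ?_⟩
      · rw [bdTo_comp_high _ hik, bdTo_comp_high _ hik]
        exact .comp hik c₁ c₂ (Cmp.bdTo hik hk.le gx gz c₃ _ _)
      · rcases le_or_gt l i with hli | hil
        · rw [bdTo_comp_low _ hi hli, bdTo_comp_low _ hi hli]
          cases ε
          · exact C₁.2 _ _ h
          · exact C₂.2 _ _ h
        · rw [bdTo_comp_high _ hil, bdTo_comp_high _ hil]
          exact .comp hil (C₁.2 _ _ h) (C₂.2 _ _ h) (Cmp.bdTo hil _ gx gz c₃ _ _)
    refine ⟨fun ε j h => ?_, glob_comp hi (glob_comp hk gx gy C₁) (glob_comp hk gz gw C₂) C₅,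
      glob_comp hk (glob_comp hi gx gz C₃) (glob_comp hi gy gw C₄) C₆⟩
    rcases le_or_gt j k with hjk | hkj
    · rw [bdTo_comp_low ε hk hjk]
      rcases le_or_gt j i with hji | hij
      · rw [bdTo_comp_low ε hi hji]
        cases ε
        · simp only [cond_false, bdTo_comp_low false hk hjk, bdTo_comp_low false hi hji]
          exact bx _ _ _
        · simp only [cond_true, bdTo_comp_low true hk hjk, bdTo_comp_low true hi hji]
          exact bw _ _ _
      · rw [bdTo_comp_high ε hij, bdTo_comp_low ε hk hjk, bdTo_comp_low ε hk hjk]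
        cases ε
        · simp only [cond_false, bdTo_comp_high false hij]
          exact .comp hij (bx _ _ _) (bz _ _ _) (Cmp.bdTo hij h gx gz c₃ _ _)
        · simp only [cond_true, bdTo_comp_high true hij]
          exact .comp hij (bY _ _ _) (bw _ _ _) (Cmp.bdTo hij h gy gw C₄.1 _ _)
    · simp only [bdTo_comp_high ε hkj, bdTo_comp_high ε (hik.trans hkj)]
      exact .exchange hik hkj (bx _ _ _) (bY _ _ _) (bz _ _ _) (bw _ _ _)
        (Cmp.bdTo hkj h gx gy c₁ _ _) (Cmp.bdTo hkj h gz gw c₂ _ _)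
        (Cmp.bdTo (hik.trans hkj) h gx gz c₃ _ _)
  | @idn_comp n k hk x y rx ry c ihx ihy ihc =>
    have hn' : n ≤ N := n.le_succ.trans hn
    have hk' : k < n + 1 := hk.trans n.lt_succ_self
    obtain ⟨bx, gx, -⟩ := ihx hn'
    obtain ⟨bY, gy, -⟩ := ihy hn'
    have c' : Cmp hk.le x y := .of gx gy c (ihc (hk.le.trans hn')).1
    have c'' : Cmp hk'.le (.idn x) (.idn y) := by
      refine ⟨?_, fun ε l h => ?_⟩
      · rw [bdTo_idn _ hk.le, bdTo_idn _ hk.le]; exact c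
      · rw [bdTo_idn _ (h.trans hk).le, bdTo_idn _ (h.trans hk).le]; exact c'.2 _ _ h
    refine ⟨fun ε j h => ?_, glob_idn (glob_comp hk gx gy c') (bdRel_comp hk gx gy bx bY c),
      glob_comp hk' (glob_idn gx bx) (glob_idn gy bY) c''⟩
    rcases h.lt_or_eq with h | rfl
    · have hj := Nat.lt_succ_iff.mp h
      rw [bdTo_idn ε hj]
      rcases le_or_gt j k with hjk | hkj
      · rw [bdTo_comp_low ε hk hjk, bdTo_comp_low ε hk' hjk]
        cases ε
        · simp only [cond_false, bdTo_idn false hj]; exact bx _ _ _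
        · simp only [cond_true, bdTo_idn true hj]; exact bY _ _ _
      · rw [bdTo_comp_high ε hkj, bdTo_comp_high ε hkj, bdTo_idn ε hj, bdTo_idn ε hj]
        exact .comp hkj (bx _ _ _) (bY _ _ _) (Cmp.bdTo hkj hj gx gy c _ _)
    · rw [bdTo_self, bdTo_self]
      exact .idn_comp hk rx ry c

/-! #### Interpretations of expressions -/

section Sound

variable {D : OmegaCat.{u}} (Ψ : ∀ n : ℕ, Raw C n → D.cell n)

/-- Compatibility of an interpretation with the boundaries of an expression. -/
def BdC {n : ℕ} (x : Raw C n) : Prop :=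
  ∀ (ε : Bool) (j : ℕ) (h : j ≤ n), Ψ j (bdTo ε h x) = D.bdTo ε h (Ψ n x)

variable {Ψ}

theorem BdC.composable {n k : ℕ} {hk : k < n} {x y : Raw C n} (bx : BdC Ψ x) (bY : BdC Ψ y)
    (c : Ψ k (bdTo true hk.le x) = Ψ k (bdTo false hk.le y)) :
    D.tgtTo hk.le (Ψ n x) = D.srcTo hk.le (Ψ n y) :=
  (bx true k hk.le).symm.trans (c.trans (bY false k hk.le))

theorem BdC.comp
    (hcomp : ∀ (n j : ℕ) (hj : j < n) (x y : Raw C n) (h),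
      Ψ n (.comp j x y) = D.comp j hj (Ψ n x) (Ψ n y) h)
    {n k : ℕ} (hk : k < n) {x y : Raw C n} (bx : BdC Ψ x) (bY : BdC Ψ y)
    (c : D.tgtTo hk.le (Ψ n x) = D.srcTo hk.le (Ψ n y)) : BdC Ψ (.comp k x y) := by
  intro ε j h
  rw [hcomp n k hk x y c]
  rcases le_or_gt j k with hjk | hkj
  · rw [bdTo_comp_low ε hk hjk, D.bdTo_comp_low ε hk hjk]
    cases ε
    · exact bx _ _ _
    · exact bY _ _ _
  · have c' := D.bdTo_composable ε hkj h c
    rw [D.bdTo_comp_high ε hk hkj h _ _ c c', bdTo_comp_high ε hkj, hcomp j k hkj]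
    · exact D.comp_congr _ (bx _ _ _) (bY _ _ _) _ _
    · rw [bx, bY]; exact c'

theorem BdC.idn (hidn : ∀ (n : ℕ) (x : Raw C n), Ψ (n + 1) (.idn x) = D.idn (Ψ n x))
    {n : ℕ} {x : Raw C n} (bx : BdC Ψ x) : BdC Ψ (.idn x) := by
  intro ε j h
  rcases h.lt_or_eq with h | rfl
  · rw [bdTo_idn ε (Nat.lt_succ_iff.mp h), D.bdTo_succ ε (Nat.lt_succ_iff.mp h), hidn, D.bd_idn]
    exact bx _ _ _
  · rw [bdTo_self, D.bdTo_self]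

theorem map_idTo_of (hidn : ∀ (n : ℕ) (x : Raw C n), Ψ (n + 1) (.idn x) = D.idn (Ψ n x))
    {k n : ℕ} (hk : k ≤ n) (x : Raw C k) : Ψ n (Raw.idTo hk x) = D.idTo hk (Ψ k x) :=
  iterUp_comm (A := Raw C) (B := D.cell) _ _ Ψ hidn hk x

theorem BdC.idTo (hidn : ∀ (n : ℕ) (x : Raw C n), Ψ (n + 1) (.idn x) = D.idn (Ψ n x))
    {k n : ℕ} (hk : k ≤ n) {x : Raw C k} (bx : BdC Ψ x) : BdC Ψ (Raw.idTo hk x) := by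
  induction n, hk using Nat.le_induction with
  | base => rwa [idTo_self]
  | succ n hk ih => rw [idTo_succ hk]; exact ih.idn hidn

/-- An interpretation that respects generators, identities and compositions respects the
congruence. -/
theorem sound (p : ℕ → Prop) (hp : ∀ i j, i ≤ j → p j → p i)
    (hgen : ∀ (n : ℕ) (z : C.cell (n + 1)) (x y : Raw C n), p (n + 1) → Rel x x → Rel y y →
      (∀ (ε : Bool) (j : ℕ) (h : j < n), Rel (bdTo ε h.le x) (bdTo ε h.le y)) →
      C.src z = eval x → C.tgt z = eval y →
      ∀ ε, D.bd ε (Ψ (n + 1) (.gen z x y)) = Ψ n (cond ε y x))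
    (hcongr : ∀ (n : ℕ) (z : C.cell (n + 1)) (x x' y y' : Raw C n), p (n + 1) →
      Rel x x' → Rel y y' →
      (∀ (ε : Bool) (j : ℕ) (h : j < n), Rel (bdTo ε h.le x) (bdTo ε h.le y)) →
      C.src z = eval x → C.tgt z = eval y →
      Ψ (n + 1) (.gen z x y) = Ψ (n + 1) (.gen z x' y'))
    (hidn : ∀ (n : ℕ) (x : Raw C n), Ψ (n + 1) (.idn x) = D.idn (Ψ n x))
    (hcomp : ∀ (n j : ℕ) (hj : j < n) (x y : Raw C n) (h),
      Ψ n (.comp j x y) = D.comp j hj (Ψ n x) (Ψ n y) h)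
    {n : ℕ} {x y : Raw C n} (r : Rel x y) (hn : p n) :
    Ψ n x = Ψ n y ∧ BdC Ψ x ∧ BdC Ψ y := by
  suffices H : ∀ N n : ℕ, n ≤ N → p n → ∀ {x y : Raw C n}, Rel x y →
      Ψ n x = Ψ n y ∧ BdC Ψ x ∧ BdC Ψ y from H n n le_rfl hn r
  clear r hn x y n
  intro N
  induction N using Nat.strong_induction_on with
  | _ N IH =>
  intro n hn pn x y r
  induction r with
  | symm r ih => obtain ⟨a, b, c⟩ := ih hn pn; exact ⟨a.symm, c, b⟩
  | trans r r' ih ih' =>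
    obtain ⟨a, b, c⟩ := ih hn pn
    obtain ⟨a', b', c'⟩ := ih' hn pn
    exact ⟨a.trans a', b, c'⟩
  | ob c =>
    have hg : BdC Ψ (Raw.ob c) := by
      intro ε j h
      obtain rfl := Nat.le_zero.mp h
      rw [bdTo_self, D.bdTo_self]
    exact ⟨rfl, hg, hg⟩
  | @gen n z x x' y y' rx ry q hs ht ihx ihy ihp =>
    have hn' : n ≤ N := n.le_succ.trans hn
    have pn' := hp _ _ n.le_succ pn
    obtain ⟨ex, bx, bx'⟩ := ihx hn' pn'
    obtain ⟨ey, bY, bY'⟩ := ihy hn' pn'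
    have e := hcongr n z x x' y y' pn rx ry q hs ht
    have hb := hgen n z x y pn rx.left ry.left q hs ht
    refine ⟨e, fun ε j h => ?_, fun ε j h => ?_⟩
    · rcases h.lt_or_eq with h | rfl
      · rw [bdTo_gen ε (Nat.lt_succ_iff.mp h), D.bdTo_succ ε (Nat.lt_succ_iff.mp h), hb]
        cases ε
        · exact bx _ _ _
        · exact bY _ _ _
      · rw [bdTo_self, D.bdTo_self]
    · rcases h.lt_or_eq with h | rfl
      · rw [bdTo_gen ε (Nat.lt_succ_iff.mp h), D.bdTo_succ ε (Nat.lt_succ_iff.mp h), ← e, hb]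
        cases ε
        · simp only [cond_false]; rw [ex]; exact bx' _ _ _
        · simp only [cond_true]; rw [ey]; exact bY' _ _ _
      · rw [bdTo_self, D.bdTo_self]
  | @idn n x y r ih =>
    obtain ⟨ex, bx, bx'⟩ := ih (n.le_succ.trans hn) (hp _ _ n.le_succ pn)
    exact ⟨by rw [hidn, hidn, ex], bx.idn hidn, bx'.idn hidn⟩
  | @comp n k hk x x' y y' rx ry rc ihx ihy ihc =>
    obtain ⟨ex, bx, bx'⟩ := ihx hn pn
    obtain ⟨ey, bY, bY'⟩ := ihy hn pn
    have c := bx.composable (hk := hk) bY (ihc (hk.le.trans hn) (hp _ _ hk.le pn)).1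
    have c' : D.tgtTo hk.le (Ψ n x') = D.srcTo hk.le (Ψ n y') := by rw [← ex, ← ey]; exact c
    refine ⟨?_, bx.comp hcomp hk bY c, bx'.comp hcomp hk bY' c'⟩
    rw [hcomp n k hk x y c, hcomp n k hk x' y' c']
    exact D.comp_congr _ ex ey _ _
  | @assoc n k hk x y z rx ry rz rc rc' ihx ihy ihz ihc ihc' =>
    obtain ⟨-, bx, -⟩ := ihx hn pn
    obtain ⟨-, bY, -⟩ := ihy hn pn
    obtain ⟨-, bz, -⟩ := ihz hn pn
    have c := bx.composable (hk := hk) bY (ihc (hk.le.trans hn) (hp _ _ hk.le pn)).1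
    have c' := bY.composable (hk := hk) bz (ihc' (hk.le.trans hn) (hp _ _ hk.le pn)).1
    have bxy := bx.comp hcomp hk bY c
    have byz := bY.comp hcomp hk bz c'
    have c₁ : D.tgtTo hk.le (Ψ n (.comp k x y)) = D.srcTo hk.le (Ψ n z) := by
      refine bxy.composable (hk := hk) bz ?_
      rw [bdTo_comp_low true hk le_rfl]; exact (ihc' (hk.le.trans hn) (hp _ _ hk.le pn)).1
    have c₂ : D.tgtTo hk.le (Ψ n x) = D.srcTo hk.le (Ψ n (.comp k y z)) := by
      refine bx.composable (hk := hk) byz ?_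
      rw [bdTo_comp_low false hk le_rfl]; exact (ihc (hk.le.trans hn) (hp _ _ hk.le pn)).1
    refine ⟨?_, bxy.comp hcomp hk bz c₁, bx.comp hcomp hk byz c₂⟩
    rw [hcomp n k hk _ _ c₁, hcomp n k hk _ _ c₂]
    have e₁ := hcomp n k hk _ _ c
    have e₂ := hcomp n k hk _ _ c'
    have c₁' := e₁ ▸ c₁
    have c₂' := e₂ ▸ c₂
    exact (D.comp_congr hk e₁ rfl c₁ c₁').trans
      ((D.comp_assoc hk _ _ _ c c₁' c' c₂').trans (D.comp_congr hk rfl e₂.symm _ _))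
  | @id_comp n k hk x rx ihx =>
    obtain ⟨-, bx, -⟩ := ihx hn pn
    have bs := (IH k (hk.trans_le hn) k le_rfl (hp _ _ hk.le pn)
      ((bdRel_of_rel rx).1 false k hk.le)).2.1
    have bi := bs.idTo hidn hk.le
    have c : D.tgtTo hk.le (Ψ n (Raw.idTo hk.le (bdTo false hk.le x))) = D.srcTo hk.le (Ψ n x) := by
      refine bi.composable (hk := hk) bx ?_
      rw [bdTo_idTo true le_rfl hk.le, idTo_self]
    refine ⟨?_, bi.comp hcomp hk bx c, bx⟩
    rw [hcomp n k hk _ _ c]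
    have e : Ψ n (Raw.idTo hk.le (bdTo false hk.le x)) = D.idTo hk.le (D.srcTo hk.le (Ψ n x)) := by
      rw [map_idTo_of hidn, bx]; rfl
    exact (D.comp_congr hk e rfl c (e ▸ c)).trans (D.id_comp hk _ _)
  | @comp_id n k hk x rx ihx =>
    obtain ⟨-, bx, -⟩ := ihx hn pn
    have bs := (IH k (hk.trans_le hn) k le_rfl (hp _ _ hk.le pn)
      ((bdRel_of_rel rx).1 true k hk.le)).2.1
    have bi := bs.idTo hidn hk.le
    have c : D.tgtTo hk.le (Ψ n x) = D.srcTo hk.le (Ψ n (Raw.idTo hk.le (bdTo true hk.le x))) := by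
      refine bx.composable (hk := hk) bi ?_
      rw [bdTo_idTo false le_rfl hk.le, idTo_self]
    refine ⟨?_, bx.comp hcomp hk bi c, bx⟩
    rw [hcomp n k hk _ _ c]
    have e : Ψ n (Raw.idTo hk.le (bdTo true hk.le x)) = D.idTo hk.le (D.tgtTo hk.le (Ψ n x)) := by
      rw [map_idTo_of hidn, bx]; rfl
    exact (D.comp_congr hk rfl e c (e ▸ c)).trans (D.comp_id hk _ _)
  | @exchange n i k hik hk x y z w rx ry rz rw_ r₁ r₂ r₃ ihx ihy ihz ihw ih₁ ih₂ ih₃ =>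
    have hi := hik.trans hk
    obtain ⟨-, bx, -⟩ := ihx hn pn
    obtain ⟨-, bY, -⟩ := ihy hn pn
    obtain ⟨-, bz, -⟩ := ihz hn pn
    obtain ⟨-, bw, -⟩ := ihw hn pn
    have c₁ := bx.composable (hk := hk) bY (ih₁ (hk.le.trans hn) (hp _ _ hk.le pn)).1
    have c₂ := bz.composable (hk := hk) bw (ih₂ (hk.le.trans hn) (hp _ _ hk.le pn)).1
    have c₃ := bx.composable (hk := hi) bz (ih₃ (hi.le.trans hn) (hp _ _ hi.le pn)).1
    have low : ∀ (ε : Bool) {a b : D.cell n}, D.tgtTo hk.le a = D.srcTo hk.le b →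
        D.bdTo ε hi.le a = D.bdTo ε hi.le b := by
      intro ε a b h
      rw [← D.bdTo_bdTo ε true hik hk.le a, ← D.bdTo_bdTo ε false hik hk.le b]
      exact congrArg _ h
    have c₄ : D.tgtTo hi.le (Ψ n y) = D.srcTo hi.le (Ψ n w) :=
      (low true c₁).symm.trans (c₃.trans (low false c₂))
    have bxy := bx.comp hcomp hk bY c₁
    have bzw := bz.comp hcomp hk bw c₂
    have bxz := bx.comp hcomp hi bz c₃
    have byw := bY.comp hcomp hi bw c₄
    have e₁ := hcomp n k hk _ _ c₁
    have e₂ := hcomp n k hk _ _ c₂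
    have e₃ := hcomp n i hi _ _ c₃
    have e₄ := hcomp n i hi _ _ c₄
    have c₅ : D.tgtTo hi.le (Ψ n (.comp k x y)) = D.srcTo hi.le (Ψ n (.comp k z w)) := by
      rw [e₁, e₂]
      refine (D.bdTo_comp_low true hk hik.le _ _ c₁).trans
        (Eq.trans ?_ (D.bdTo_comp_low false hk hik.le _ _ c₂).symm)
      exact (low true c₁).symm.trans c₃
    have c₆ : D.tgtTo hk.le (Ψ n (.comp i x z)) = D.srcTo hk.le (Ψ n (.comp i y w)) := by
      rw [e₃, e₄]
      have c₃' := D.bdTo_composable true hik hk.le c₃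
      have c₄' := D.bdTo_composable false hik hk.le c₄
      refine (D.bdTo_comp_high true hi hik hk.le _ _ c₃ c₃').trans
        (Eq.trans ?_ (D.bdTo_comp_high false hi hik hk.le _ _ c₄ c₄').symm)
      exact D.comp_congr _ c₁ c₂ _ _
    refine ⟨?_, bxy.comp hcomp hi bzw c₅, bxz.comp hcomp hk byw c₆⟩
    rw [hcomp n i hi _ _ c₅, hcomp n k hk _ _ c₆]
    have c₅' := c₅
    have c₆' := c₆
    rw [e₁, e₂] at c₅'
    rw [e₃, e₄] at c₆'
    exact (D.comp_congr hi e₁ e₂ _ c₅').trans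
      ((D.exchange hik hk _ _ _ _ c₁ c₂ c₅' c₃ c₄ c₆').trans
        (D.comp_congr hk e₃.symm e₄.symm _ _))
  | @idn_comp n k hk x y rx ry rc ihx ihy ihc =>
    have hn' : n ≤ N := n.le_succ.trans hn
    have pn' := hp _ _ n.le_succ pn
    have hk' : k < n + 1 := hk.trans n.lt_succ_self
    obtain ⟨-, bx, -⟩ := ihx hn' pn'
    obtain ⟨-, bY, -⟩ := ihy hn' pn'
    have hc := (ihc (hk.le.trans hn') (hp _ _ hk.le pn')).1
    have c := bx.composable (hk := hk) bY hc
    have c' : D.tgtTo hk'.le (Ψ (n + 1) (.idn x)) = D.srcTo hk'.le (Ψ (n + 1) (.idn y)) := by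
      refine (bx.idn hidn).composable (hk := hk') (bY.idn hidn) ?_
      rw [bdTo_idn _ hk.le, bdTo_idn _ hk.le]; exact hc
    refine ⟨?_, (bx.comp hcomp hk bY c).idn hidn,
      (bx.idn hidn).comp hcomp hk' (bY.idn hidn) c'⟩
    have c'' := c'
    rw [hidn, hidn] at c''
    rw [hidn, hcomp n k hk _ _ c, hcomp (n + 1) k hk' _ _ c', D.idn_comp hk _ _ c c'']
    exact D.comp_congr _ (hidn _ _).symm (hidn _ _).symm _ _

end Sound

theorem eval_comp {n j : ℕ} (hj : j < n) (x y : Raw C n)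
    (h : C.tgtTo hj.le (eval x) = C.srcTo hj.le (eval y)) :
    eval (.comp j x y) = C.comp j hj (eval x) (eval y) h := by
  have H : ∃ hj : j < n, C.tgtTo hj.le (eval x) = C.srcTo hj.le (eval y) := ⟨hj, h⟩
  rw [eval, dif_pos H]

theorem eval_sound {n : ℕ} {x y : Raw C n} (r : Rel x y) :
    eval x = eval y ∧ BdC (fun _ => eval) x ∧ BdC (fun _ => eval) y := by
  refine sound (Ψ := fun _ => eval) (fun _ => True) (fun _ _ _ _ => trivial) ?_ ?_ ?_ ?_ r trivial
  · intro n z x y _ _ _ _ hs ht ε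
    cases ε
    · exact hs
    · exact ht
  · intros; rfl
  · intros; rfl
  · intro n j hj x y h; exact eval_comp hj x y h

/-- Conditions for an expression to be well-formed, in terms of its subexpressions. -/
def Inv : ∀ {n : ℕ}, Raw C n → Prop
  | _, .ob _ => True
  | n + 1, .gen z x y => Rel x x ∧ Rel y y ∧
      (∀ (ε : Bool) (j : ℕ) (h : j < n), Rel (bdTo ε h.le x) (bdTo ε h.le y)) ∧
      C.src z = eval x ∧ C.tgt z = eval y
  | _, .idn x => Rel x x
  | n, .comp j x y => Rel x x ∧ Rel y y ∧
      ∃ hj : j < n, Rel (bdTo true hj.le x) (bdTo false hj.le y)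

theorem Rel.inv {n : ℕ} {x y : Raw C n} (r : Rel x y) : Inv x ∧ Inv y := by
  induction r with
  | symm r ih => exact ih.symm
  | trans r r' ih ih' => exact ⟨ih.1, ih'.2⟩
  | ob c => exact ⟨trivial, trivial⟩
  | gen rx ry q hs ht =>
    refine ⟨⟨rx.left, ry.left, q, hs, ht⟩, rx.right, ry.right, fun ε j h => ?_,
      hs.trans (eval_sound rx).1, ht.trans (eval_sound ry).1⟩
    exact ((bdRel_of_rel rx).1 ε j h.le).symm.trans
      ((q ε j h).trans ((bdRel_of_rel ry).1 ε j h.le))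
  | idn r => exact ⟨r.left, r.right⟩
  | comp hk rx ry rc =>
    exact ⟨⟨rx.left, ry.left, hk, rc⟩, rx.right, ry.right, hk,
      ((bdRel_of_rel rx).1 _ _ _).symm.trans (rc.trans ((bdRel_of_rel ry).1 _ _ _))⟩
  | @assoc n k hk x y z rx ry rz rc rc' =>
    refine ⟨⟨.comp hk rx ry rc, rz, hk, ?_⟩, rx, .comp hk ry rz rc', hk, ?_⟩
    · rw [bdTo_comp_low true hk le_rfl]; exact rc'
    · rw [bdTo_comp_low false hk le_rfl]; exact rc
  | @id_comp n k hk x rx ih =>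
    have rs := (bdRel_of_rel rx).1 false k hk.le
    refine ⟨⟨rs.idTo hk.le, rx, hk, ?_⟩, ih.1⟩
    rw [bdTo_idTo true le_rfl hk.le, idTo_self]; exact rs
  | @comp_id n k hk x rx ih =>
    have rs := (bdRel_of_rel rx).1 true k hk.le
    refine ⟨⟨rx, rs.idTo hk.le, hk, ?_⟩, ih.1⟩
    rw [bdTo_idTo false le_rfl hk.le, idTo_self]; exact rs
  | @exchange n i k hik hk x y z w rx ry rz rw' r₁ r₂ r₃ =>
    have hi := hik.trans hk
    have gx := (bdRel_of_rel rx).2.1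
    have gy := (bdRel_of_rel ry).2.1
    have gz := (bdRel_of_rel rz).2.1
    have gw := (bdRel_of_rel rw').2.1
    have C₁ : Cmp hk.le x y := .of gx gy r₁ (bdRel_of_rel r₁).1
    have C₂ : Cmp hk.le z w := .of gz gw r₂ (bdRel_of_rel r₂).1
    have c₄ := (C₁.2 true _ hik).symm.trans (r₃.trans (C₂.2 false _ hik))
    refine ⟨⟨.comp hk rx ry r₁, .comp hk rz rw' r₂, hi, ?_⟩,
      .comp hi rx rz r₃, .comp hi ry rw' c₄, hk, ?_⟩
    · rw [bdTo_comp_low _ hk hik.le, bdTo_comp_low _ hk hik.le]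
      exact (C₁.2 _ _ hik).symm.trans r₃
    · rw [bdTo_comp_high _ hik, bdTo_comp_high _ hik]
      exact .comp hik r₁ r₂ (Cmp.bdTo hik hk.le gx gz r₃ _ _)
  | @idn_comp n k hk x y rx ry rc =>
    refine ⟨.comp hk rx ry rc, rx.idn, ry.idn, hk.trans n.lt_succ_self, ?_⟩
    rw [bdTo_idn _ hk.le, bdTo_idn _ hk.le]; exact rc

theorem Rel.bd (ε : Bool) {n : ℕ} {x y : Raw C (n + 1)} (r : Rel x y) :
    Rel (Raw.bd ε x : Raw C n) (Raw.bd ε y : Raw C n) := by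
  have h := (bdRel_of_rel r).1 ε n n.le_succ
  rwa [bdTo_succ ε le_rfl, bdTo_succ ε le_rfl, bdTo_self, bdTo_self] at h

/-- The action of an ω-functor on expressions. -/
def map {D : OmegaCat.{u}} (f : C ⟶ D) : ∀ {n : ℕ}, Raw C n → Raw D n
  | _, .ob c => .ob (f.map c)
  | _, .gen z x y => .gen (f.map z) (map f x) (map f y)
  | _, .idn x => .idn (map f x)
  | _, .comp j x y => .comp j (map f x) (map f y)

theorem map_bd {D : OmegaCat.{u}} (f : C ⟶ D) (ε : Bool) {n : ℕ} (x : Raw C n) :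
    map f (bd ε x) = bd ε (map f x) := by
  induction x with
  | ob c => rfl
  | gen z x y => cases ε <;> rfl
  | idn x => rfl
  | @comp n j x y ihx ihy =>
    simp only [bd, map]
    split
    · cases ε
      · exact ihx
      · exact ihy
    · simp only [map, ihx, ihy]

theorem map_bdTo {D : OmegaCat.{u}} (f : C ⟶ D) (ε : Bool) {j n : ℕ} (h : j ≤ n) (x : Raw C n) :
    map f (bdTo ε h x) = bdTo ε h (map f x) :=
  iterDown_comm (A := Raw C) (B := Raw D) _ _ (fun _ => map f) (fun _ x => map_bd f ε x) h x

theorem map_idTo {D : OmegaCat.{u}} (f : C ⟶ D) {j n : ℕ} (h : j ≤ n) (x : Raw C j) :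
    map f (idTo h x) = idTo h (map f x) :=
  iterUp_comm (A := Raw C) (B := Raw D) _ _ (fun _ => map f) (fun _ _ => rfl) h x

theorem eval_map {D : OmegaCat.{u}} (f : C ⟶ D) {n : ℕ} (x : Raw C n) (r : Rel x x) :
    eval (map f x) = f.map (eval x) := by
  induction x with
  | ob c => rfl
  | gen z x y => rfl
  | idn x ih => exact (congrArg D.idn (ih r.inv.1)).trans (f.map_idn _).symm
  | @comp n j x y ihx ihy =>
    obtain ⟨rx, ry, hj, rc⟩ := r.inv.1
    have c := (eval_sound rx).2.1.composable (hk := hj) (eval_sound ry).2.1 (eval_sound rc).1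
    have c' := f.map_composable hj.le c
    have c'' : D.tgtTo hj.le (eval (map f x)) = D.srcTo hj.le (eval (map f y)) := by
      rw [ihx rx, ihy ry]; exact c'
    rw [eval_comp hj x y c, f.map_comp hj _ _ c c', map, eval_comp hj _ _ c'']
    exact D.comp_congr _ (ihx rx) (ihy ry) _ _

theorem Rel.map {D : OmegaCat.{u}} (f : C ⟶ D) {n : ℕ} {x y : Raw C n} (r : Rel x y) :
    Rel (Raw.map f x) (Raw.map f y) := by
  induction r with
  | symm _ ih => exact ih.symm
  | trans _ _ ih ih' => exact ih.trans ih'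
  | ob c => exact .ob _
  | gen rx ry q hs ht ihx ihy ihq =>
    refine .gen ihx ihy (fun ε j h => ?_) ?_ ?_
    · rw [← map_bdTo, ← map_bdTo]; exact ihq ε j h
    · rw [eval_map f _ rx.left, ← hs]; exact (f.map_src _).symm
    · rw [eval_map f _ ry.left, ← ht]; exact (f.map_tgt _).symm
  | idn _ ih => exact .idn ih
  | comp hk _ _ _ ihx ihy ihc =>
    rw [map_bdTo, map_bdTo] at ihc
    exact .comp hk ihx ihy ihc
  | assoc hk _ _ _ _ _ ihx ihy ihz ihc ihc' =>
    rw [map_bdTo, map_bdTo] at ihc ihc'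
    exact .assoc hk ihx ihy ihz ihc ihc'
  | id_comp hk _ ih =>
    rw [Raw.map, map_idTo, map_bdTo]
    exact .id_comp hk ih
  | comp_id hk _ ih =>
    rw [Raw.map, map_idTo, map_bdTo]
    exact .comp_id hk ih
  | exchange hik hk _ _ _ _ _ _ _ ihx ihy ihz ihw ih₁ ih₂ ih₃ =>
    rw [map_bdTo, map_bdTo] at ih₁ ih₂ ih₃
    exact .exchange hik hk ihx ihy ihz ihw ih₁ ih₂ ih₃
  | idn_comp hk _ _ _ ihx ihy ihc =>
    rw [map_bdTo, map_bdTo] at ihc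
    exact .idn_comp hk ihx ihy ihc

theorem map_id {n : ℕ} (x : Raw C n) : map (𝟙 C) x = x := by
  induction x with
  | ob c => rfl
  | gen z x y ihx ihy => rw [map, ihx, ihy]; rfl
  | idn x ih => rw [map, ih]
  | comp j x y ihx ihy => rw [map, ihx, ihy]

theorem map_map {D E : OmegaCat.{u}} (f : C ⟶ D) (g : D ⟶ E) {n : ℕ} (x : Raw C n) :
    map (f ≫ g) x = map g (map f x) := by
  induction x with
  | ob c => rfl
  | gen z x y ihx ihy => rw [map, ihx, ihy]; rfl
  | idn x ih => rw [map, ih]; rfl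
  | comp j x y ihx ihy => rw [map, ihx, ihy]; rfl

end Raw

namespace OmegaCat

/-! #### The free ω-category on the polygraph of an ω-category -/

/-- Well-formed expressions up to congruence. -/
def cellSetoid (C : OmegaCat.{u}) (n : ℕ) : Setoid {x : Raw C n // Raw.Rel x x} where
  r x y := Raw.Rel x.1 y.1
  iseqv := ⟨fun x => x.2, fun h => h.symm, fun h h' => h.trans h'⟩

/-- The `n`-cells of the free ω-category on `W(C)`. -/
def StarCell (C : OmegaCat.{u}) (n : ℕ) : Type u := Quotient (cellSetoid C n)

namespace StarCell

variable {C : OmegaCat.{u}}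

/-- The cell given by a well-formed expression. -/
def mk {n : ℕ} (x : Raw C n) (h : Raw.Rel x x) : StarCell C n :=
  Quotient.mk (cellSetoid C n) ⟨x, h⟩

/-- An expression for a given cell. -/
noncomputable def rep {n : ℕ} (q : StarCell C n) : Raw C n := (Quotient.out q).1

theorem rel_rep {n : ℕ} (q : StarCell C n) : Raw.Rel q.rep q.rep := (Quotient.out q).2

theorem mk_rep {n : ℕ} (q : StarCell C n) : mk q.rep q.rel_rep = q := Quotient.out_eq q

theorem mk_eq_mk {n : ℕ} {x y : Raw C n} {hx : Raw.Rel x x} {hy : Raw.Rel y y} :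
    mk x hx = mk y hy ↔ Raw.Rel x y :=
  ⟨fun h => Quotient.exact (s := cellSetoid C n) h, fun h => Quotient.sound (s := cellSetoid C n) h⟩

theorem rep_mk {n : ℕ} (x : Raw C n) (h : Raw.Rel x x) : Raw.Rel (mk x h).rep x :=
  mk_eq_mk.mp (mk_rep (mk x h))

theorem exists_rep {n : ℕ} (q : StarCell C n) : ∃ x h, mk x h = q := ⟨q.rep, q.rel_rep, q.mk_rep⟩

/-- The source (`false`) and target (`true`) of a cell. -/
noncomputable def bd (ε : Bool) {n : ℕ} (q : StarCell C (n + 1)) : StarCell C n :=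
  mk (Raw.bd ε q.rep : Raw C n) (q.rel_rep.bd ε)

theorem bd_mk (ε : Bool) {n : ℕ} (x : Raw C (n + 1)) (h : Raw.Rel x x) :
    bd ε (mk x h) = mk (Raw.bd ε x : Raw C n) (h.bd ε) :=
  mk_eq_mk.mpr ((rep_mk x h).bd ε)

theorem bd_bd (ε δ : Bool) {n : ℕ} (q : StarCell C (n + 2)) : bd ε (bd δ q) = bd ε (bd ε q) := by
  obtain ⟨x, h, rfl⟩ := q.exists_rep
  simp only [bd_mk]
  refine mk_eq_mk.mpr ?_
  have H : ∀ δ, Raw.Rel (Raw.bd ε (Raw.bd δ x : Raw C (n + 1)) : Raw C n)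
      (Raw.bdTo ε (n.le_succ.trans (n + 1).le_succ) x) := by
    intro δ
    have h1 := (Raw.bdRel_of_rel h).2.1 ε δ n (n + 1) n.lt_succ_self (n + 1).le_succ
    rwa [Raw.bdTo_succ ε le_rfl, Raw.bdTo_self, Raw.bdTo_succ δ le_rfl, Raw.bdTo_self] at h1
  exact (H δ).trans (H ε).symm

end StarCell

/-- The globular set underlying the free ω-category on `W(C)`. -/
noncomputable abbrev starGlob (C : OmegaCat.{u}) : GlobularSet.{u} where
  cell := StarCell C
  src := StarCell.bd false
  tgt := StarCell.bd true
  src_src x := (StarCell.bd_bd false true x).symm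
  tgt_src x := StarCell.bd_bd true false x

namespace StarCell

variable {C : OmegaCat.{u}}

theorem starGlob_bd (ε : Bool) {n : ℕ} (q : StarCell C (n + 1)) :
    C.starGlob.bd ε q = StarCell.bd ε q := by cases ε <;> rfl

theorem bdTo_mk (ε : Bool) {j n : ℕ} (h : j ≤ n) (x : Raw C n) (r : Raw.Rel x x) :
    C.starGlob.bdTo ε h (mk x r) = mk (Raw.bdTo ε h x) ((Raw.bdRel_of_rel r).1 ε j h) := by
  induction n, h using Nat.le_induction with
  | base => rw [C.starGlob.bdTo_self]; exact mk_eq_mk.mpr (by rwa [Raw.bdTo_self])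
  | succ n h ih =>
    rw [C.starGlob.bdTo_succ ε h, starGlob_bd, bd_mk, ih]
    exact mk_eq_mk.mpr (by
      rw [Raw.bdTo_succ ε h]; exact (Raw.bdRel_of_rel (r.bd ε)).1 ε j h)

theorem composable_iff {j n : ℕ} (h : j ≤ n) (x y : Raw C n) (rx : Raw.Rel x x)
    (ry : Raw.Rel y y) : C.starGlob.tgtTo h (mk x rx) = C.starGlob.srcTo h (mk y ry) ↔
      Raw.Rel (Raw.bdTo true h x) (Raw.bdTo false h y) := by
  rw [← C.starGlob.bdTo_true, ← C.starGlob.bdTo_false, bdTo_mk, bdTo_mk, mk_eq_mk]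

theorem rel_comp {j n : ℕ} (hj : j < n) (p q : StarCell C n)
    (h : C.starGlob.tgtTo hj.le p = C.starGlob.srcTo hj.le q) :
    Raw.Rel (.comp j p.rep q.rep) (.comp j p.rep q.rep) :=
  .comp hj p.rel_rep q.rel_rep ((composable_iff hj.le _ _ p.rel_rep q.rel_rep).mp (by
    rw [mk_rep, mk_rep]; exact h))

/-- Composition of cells. -/
noncomputable def comp {n : ℕ} (j : ℕ) (hj : j < n) (p q : StarCell C n)
    (h : C.starGlob.tgtTo hj.le p = C.starGlob.srcTo hj.le q) : StarCell C n :=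
  mk (.comp j p.rep q.rep) (rel_comp hj p q h)

theorem comp_mk {j n : ℕ} (hj : j < n) (x y : Raw C n) (rx : Raw.Rel x x)
    (ry : Raw.Rel y y) (h) (r : Raw.Rel (.comp j x y) (.comp j x y)) :
    comp j hj (mk x rx) (mk y ry) h = mk (.comp j x y) r :=
  mk_eq_mk.mpr (.comp hj (rep_mk x rx) (rep_mk y ry)
    (((Raw.bdRel_of_rel (rep_mk x rx)).1 _ _ _).trans
      (((composable_iff hj.le x y rx ry).mp h).trans
        ((Raw.bdRel_of_rel (rep_mk y ry)).1 _ _ _).symm)))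

/-- Identities on cells. -/
noncomputable def idn {n : ℕ} (q : StarCell C n) : StarCell C (n + 1) := mk (.idn q.rep) q.rel_rep.idn

theorem idn_mk {n : ℕ} (x : Raw C n) (r : Raw.Rel x x) : idn (mk x r) = mk (.idn x) r.idn :=
  mk_eq_mk.mpr (rep_mk x r).idn

theorem idTo_mk {j n : ℕ} (h : j ≤ n) (x : Raw C j) (r : Raw.Rel x x) :
    iterUp (A := C.starGlob.cell) (fun _ => idn) h (mk x r) = mk (Raw.idTo h x) (r.idTo h) := by
  induction n, h using Nat.le_induction with
  | base => rw [iterUp_self]; exact mk_eq_mk.mpr (by rwa [Raw.idTo_self])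
  | succ n h ih =>
    rw [iterUp_succ _ h, ih]
    refine (idn_mk _ _).trans ?_
    exact mk_eq_mk.mpr (by rw [Raw.idTo_succ h]; exact (r.idTo h).idn)

theorem bd_comp (ε : Bool) {n j : ℕ} (hj : j < n) (p q : StarCell C (n + 1)) (h h') :
    bd ε (comp j (hj.trans n.lt_succ_self) p q h) = comp j hj (bd ε p) (bd ε q) h' := by
  obtain ⟨x, rx, rfl⟩ := p.exists_rep
  obtain ⟨y, ry, rfl⟩ := q.exists_rep
  have c := (composable_iff _ x y rx ry).mp h
  have r : Raw.Rel (.comp j x y) (.comp j x y) := .comp (hj.trans n.lt_succ_self) rx ry c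
  have e : (Raw.bd ε (Raw.comp j x y) : Raw C n) = .comp j (Raw.bd ε x) (Raw.bd ε y) := by
    simp [Raw.bd, hj.ne]
  have r' := r.bd ε
  rw [e] at r'
  rw [comp_mk _ x y rx ry h r, bd_mk]
  have H : ∀ (p q : StarCell C n) (_ : p = mk _ (rx.bd ε)) (_ : q = mk _ (ry.bd ε)) (h'),
      mk (Raw.bd ε (Raw.comp j x y) : Raw C n) (r.bd ε) = comp j hj p q h' := by
    rintro p q rfl rfl h'
    rw [comp_mk hj _ _ _ _ h' r']
    exact mk_eq_mk.mpr (by rw [e]; exact r')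
  exact H _ _ (bd_mk ..) (bd_mk ..) h'

theorem bd_comp_top (ε : Bool) {n : ℕ} (p q : StarCell C (n + 1)) (h) :
    bd ε (comp n n.lt_succ_self p q h) = bd ε (cond ε q p) := by
  obtain ⟨x, rx, rfl⟩ := p.exists_rep
  obtain ⟨y, ry, rfl⟩ := q.exists_rep
  have c := (composable_iff _ x y rx ry).mp h
  have r : Raw.Rel (.comp n x y) (.comp n x y) := .comp n.lt_succ_self rx ry c
  rw [comp_mk _ x y rx ry h r, bd_mk]
  cases ε
  · refine Eq.trans ?_ (bd_mk _ _ _).symm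
    exact mk_eq_mk.mpr (by simpa [Raw.bd] using rx.bd false)
  · refine Eq.trans ?_ (bd_mk _ _ _).symm
    exact mk_eq_mk.mpr (by simpa [Raw.bd] using ry.bd true)

end StarCell

open StarCell in
/-- The free ω-category on the polygraph `W(C)`. -/
noncomputable def star (C : OmegaCat.{u}) : OmegaCat.{u} where
  toGlobularSet := C.starGlob
  idn := StarCell.idn
  comp := StarCell.comp
  src_idn q := by
    obtain ⟨x, h, rfl⟩ := StarCell.exists_rep q
    exact (congrArg _ (idn_mk x h)).trans (bd_mk false _ _)
  tgt_idn q := by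
    obtain ⟨x, h, rfl⟩ := StarCell.exists_rep q
    exact (congrArg _ (idn_mk x h)).trans (bd_mk true _ _)
  src_comp_top := bd_comp_top false
  tgt_comp_top := bd_comp_top true
  src_comp := bd_comp false
  tgt_comp := bd_comp true
  comp_assoc hj p q r h₁ h₂ h₃ h₄ := by
    obtain ⟨x, rx, rfl⟩ := StarCell.exists_rep p
    obtain ⟨y, ry, rfl⟩ := StarCell.exists_rep q
    obtain ⟨z, rz, rfl⟩ := StarCell.exists_rep r
    have c := (composable_iff _ x y rx ry).mp h₁
    have c' := (composable_iff _ y z ry rz).mp h₃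
    have R := Raw.Rel.assoc hj rx ry rz c c'
    have e₁ := comp_mk hj x y rx ry h₁ (.comp hj rx ry c)
    have e₂ := comp_mk hj y z ry rz h₃ (.comp hj ry rz c')
    have E₁ : ∀ p (_ : p = StarCell.mk _ (Raw.Rel.comp hj rx ry c)) (h), StarCell.comp _ hj p (StarCell.mk z rz) h =
        StarCell.mk _ R.left := by rintro p rfl h; exact comp_mk ..
    have E₂ : ∀ p (_ : p = StarCell.mk _ (Raw.Rel.comp hj ry rz c')) (h), StarCell.comp _ hj (StarCell.mk x rx) p h =
        StarCell.mk _ R.right := by rintro p rfl h; exact comp_mk ..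
    exact (E₁ _ e₁ h₂).trans ((mk_eq_mk.mpr R).trans (E₂ _ e₂ h₄).symm)
  id_comp hj p h := by
    obtain ⟨x, rx, rfl⟩ := StarCell.exists_rep p
    have R := Raw.Rel.id_comp hj rx
    have rs := (Raw.bdRel_of_rel rx).1 false _ hj.le
    have E : ∀ p (_ : p = StarCell.mk _ (rs.idTo hj.le)) (h), StarCell.comp _ hj p (StarCell.mk x rx) h =
        StarCell.mk _ R.left := by rintro p rfl h; exact comp_mk ..
    refine (E _ ?_ h).trans (mk_eq_mk.mpr R)
    rw [← C.starGlob.bdTo_false, bdTo_mk]; exact idTo_mk ..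
  comp_id hj p h := by
    obtain ⟨x, rx, rfl⟩ := StarCell.exists_rep p
    have R := Raw.Rel.comp_id hj rx
    have rs := (Raw.bdRel_of_rel rx).1 true _ hj.le
    have E : ∀ p (_ : p = StarCell.mk _ (rs.idTo hj.le)) (h), StarCell.comp _ hj (StarCell.mk x rx) p h =
        StarCell.mk _ R.left := by rintro p rfl h; exact comp_mk ..
    refine (E _ ?_ h).trans (mk_eq_mk.mpr R)
    rw [← C.starGlob.bdTo_true, bdTo_mk]; exact idTo_mk ..
  exchange hij hj p q r s h₁ h₂ h₃ h₄ h₅ h₆ := by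
    obtain ⟨x, rx, rfl⟩ := StarCell.exists_rep p
    obtain ⟨y, ry, rfl⟩ := StarCell.exists_rep q
    obtain ⟨z, rz, rfl⟩ := StarCell.exists_rep r
    obtain ⟨w, rw', rfl⟩ := StarCell.exists_rep s
    have c₁ := (composable_iff _ x y rx ry).mp h₁
    have c₂ := (composable_iff _ z w rz rw').mp h₂
    have c₄ := (composable_iff _ x z rx rz).mp h₄
    have c₅ := (composable_iff _ y w ry rw').mp h₅
    have R := Raw.Rel.exchange hij hj rx ry rz rw' c₁ c₂ c₄
    have hi := hij.trans hj
    have E₁ : ∀ p q (_ : p = StarCell.mk _ (Raw.Rel.comp hj rx ry c₁))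
        (_ : q = StarCell.mk _ (Raw.Rel.comp hj rz rw' c₂)) (h), StarCell.comp _ hi p q h =
        StarCell.mk _ R.left := by rintro p q rfl rfl h; exact comp_mk ..
    have E₂ : ∀ p q (_ : p = StarCell.mk _ (Raw.Rel.comp hi rx rz c₄))
        (_ : q = StarCell.mk _ (Raw.Rel.comp hi ry rw' c₅)) (h), StarCell.comp _ hj p q h =
        StarCell.mk _ R.right := by rintro p q rfl rfl h; exact comp_mk ..
    exact (E₁ _ _ (comp_mk ..) (comp_mk ..) h₃).trans
      ((mk_eq_mk.mpr R).trans (E₂ _ _ (comp_mk ..) (comp_mk ..) h₆).symm)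
  idn_comp hj p q h h' := by
    obtain ⟨x, rx, rfl⟩ := StarCell.exists_rep p
    obtain ⟨y, ry, rfl⟩ := StarCell.exists_rep q
    have c := (composable_iff _ x y rx ry).mp h
    have R := Raw.Rel.idn_comp hj rx ry c
    have E : ∀ p q (_ : p = StarCell.mk _ rx.idn) (_ : q = StarCell.mk _ ry.idn) (h),
        StarCell.comp _ (hj.trans (Nat.lt_succ_self _)) p q h = StarCell.mk _ R.right := by
      rintro p q rfl rfl h; exact comp_mk ..
    exact ((congrArg StarCell.idn (comp_mk hj x y rx ry h (.comp hj rx ry c))).trans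
      (idn_mk _ _)).trans ((mk_eq_mk.mpr R).trans (E _ _ (idn_mk ..) (idn_mk ..) h').symm)

/-- The counit: the ω-functor from the free ω-category on `W(C)` to `C`. -/
noncomputable def counit (C : OmegaCat.{u}) : C.star ⟶ C where
  map q := Raw.eval (StarCell.rep q)
  map_src q := by
    have h := (Raw.eval_sound (StarCell.rel_rep q)).2.1 false _ (Nat.le_succ _)
    rw [Raw.bdTo_succ false le_rfl, Raw.bdTo_self, C.bdTo_succ false le_rfl, C.bdTo_self] at h
    exact (Raw.eval_sound (StarCell.rep_mk _ _)).1.trans h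
  map_tgt q := by
    have h := (Raw.eval_sound (StarCell.rel_rep q)).2.1 true _ (Nat.le_succ _)
    rw [Raw.bdTo_succ true le_rfl, Raw.bdTo_self, C.bdTo_succ true le_rfl, C.bdTo_self] at h
    exact (Raw.eval_sound (StarCell.rep_mk _ _)).1.trans h
  map_idn q := (Raw.eval_sound (StarCell.rep_mk _ _)).1
  map_comp hj p q h h' := (Raw.eval_sound (StarCell.rep_mk _ _)).1.trans (Raw.eval_comp hj _ _ h')

theorem counit_mk {C : OmegaCat.{u}} {n : ℕ} (x : Raw C n) (h : Raw.Rel x x) :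
    C.counit.map (StarCell.mk x h) = Raw.eval x :=
  (Raw.eval_sound (StarCell.rep_mk x h)).1

/-- The `(n + 1)`-generators of `W(C)`: triples `(z, x, y)` with `x`, `y` parallel `n`-cells of the
free ω-category and `z` an `(n + 1)`-cell of `C` from the value of `x` to the value of `y`. -/
@[ext]
structure Triple (C : OmegaCat.{u}) (n : ℕ) : Type u where
  z : C.cell (n + 1)
  x : C.star.cell n
  y : C.star.cell n
  parallel : C.star.Parallel x y
  src_z : C.src z = C.counit.map x
  tgt_z : C.tgt z = C.counit.map y

/-- The generators of `W(C)`. -/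
def WGen (C : OmegaCat.{u}) : ℕ → Type u
  | 0 => C.cell 0
  | n + 1 => C.Triple n

theorem Triple.rel {C : OmegaCat.{u}} {n : ℕ} (t : C.Triple n) :
    Raw.Rel (.gen t.z (StarCell.rep t.x) (StarCell.rep t.y))
      (.gen t.z (StarCell.rep t.x) (StarCell.rep t.y)) := by
  refine .gen (StarCell.rel_rep _) (StarCell.rel_rep _) ?_ t.src_z t.tgt_z
  obtain ⟨z, x, y, p, -, -⟩ := t
  intro ε j h
  cases n with
  | zero => exact absurd h (Nat.not_lt_zero _)
  | succ n =>
    have hj := Nat.lt_succ_iff.mp h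
    have r : Raw.Rel (Raw.bd ε (StarCell.rep x) : Raw C n) (Raw.bd ε (StarCell.rep y) : Raw C n) :=
      StarCell.mk_eq_mk (hx := (StarCell.rel_rep x).bd ε) (hy := (StarCell.rel_rep y).bd ε)|>.mp (by
        cases ε
        · exact p.1
        · exact p.2)
    rw [Raw.bdTo_succ ε hj, Raw.bdTo_succ ε hj]
    exact (Raw.bdRel_of_rel r).1 ε j hj

/-- The inclusion of the generators of `W(C)` into the free ω-category. -/
noncomputable def wInc (C : OmegaCat.{u}) : ∀ {n : ℕ}, C.WGen n → C.star.cell n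
  | 0, c => StarCell.mk (.ob c) (.ob c)
  | _ + 1, t => StarCell.mk (.gen t.z (StarCell.rep t.x) (StarCell.rep t.y)) t.rel

/-- The triple given by a well-formed formal generator. -/
def Triple.ofRel {C : OmegaCat.{u}} {n : ℕ} {z : C.cell (n + 1)} {x y : Raw C n}
    (r : Raw.Rel (.gen z x y) (.gen z x y)) : C.Triple n where
  z := z
  x := StarCell.mk x r.inv.1.1
  y := StarCell.mk y r.inv.1.2.1
  parallel := by
    cases n with
    | zero => trivial
    | succ n =>
      have H : ∀ ε, StarCell.bd ε (StarCell.mk x r.inv.1.1) =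
          StarCell.bd ε (StarCell.mk y r.inv.1.2.1) := by
        intro ε
        have h := r.inv.1.2.2.1 ε n n.lt_succ_self
        rw [Raw.bdTo_succ ε le_rfl, Raw.bdTo_succ ε le_rfl, Raw.bdTo_self, Raw.bdTo_self] at h
        rw [StarCell.bd_mk, StarCell.bd_mk]
        exact StarCell.mk_eq_mk.mpr h
      exact ⟨H false, H true⟩
  src_z := by rw [counit_mk]; exact r.inv.1.2.2.2.1
  tgt_z := by rw [counit_mk]; exact r.inv.1.2.2.2.2

theorem wInc_ofRel {C : OmegaCat.{u}} {n : ℕ} {z : C.cell (n + 1)} {x y : Raw C n}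
    (r : Raw.Rel (.gen z x y) (.gen z x y)) :
    C.wInc (n := n + 1) (Triple.ofRel r) = StarCell.mk (.gen z x y) r := by
  refine StarCell.mk_eq_mk.mpr (Raw.Rel.symm ?_)
  obtain ⟨rx, ry, q, hs, ht⟩ := r.inv.1
  exact .gen (StarCell.rep_mk x rx).symm (StarCell.rep_mk y ry).symm q hs ht

theorem ofRel_rel {C : OmegaCat.{u}} {n : ℕ} (t : C.Triple n) : Triple.ofRel t.rel = t := by
  refine Triple.ext rfl ?_ ?_
  · exact StarCell.mk_rep _
  · exact StarCell.mk_rep _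

theorem ofRel_congr {C : OmegaCat.{u}} {n : ℕ} {z : C.cell (n + 1)} {x y x' y' : Raw C n}
    (r : Raw.Rel (.gen z x y) (.gen z x y)) (r' : Raw.Rel (.gen z x' y') (.gen z x' y'))
    (hx : Raw.Rel x x') (hy : Raw.Rel y y') : Triple.ofRel r = Triple.ofRel r' := by
  refine Triple.ext rfl ?_ ?_
  · exact StarCell.mk_eq_mk.mpr hx
  · exact StarCell.mk_eq_mk.mpr hy

theorem src_wInc {C : OmegaCat.{u}} {n : ℕ} (t : C.Triple n) :
    C.star.src (C.wInc (n := n + 1) t) = t.x :=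
  (StarCell.bd_mk false _ _).trans (StarCell.mk_rep _)

theorem tgt_wInc {C : OmegaCat.{u}} {n : ℕ} (t : C.Triple n) :
    C.star.tgt (C.wInc (n := n + 1) t) = t.y :=
  (StarCell.bd_mk true _ _).trans (StarCell.mk_rep _)

theorem counit_wInc {C : OmegaCat.{u}} {n : ℕ} (t : C.Triple n) :
    C.counit.map (C.wInc (n := n + 1) t) = t.z := counit_mk _ _

theorem wInc_injective (C : OmegaCat.{u}) (n : ℕ) :
    Function.Injective (C.wInc : C.WGen n → C.star.cell n) := by
  cases n with
  | zero =>
    intro a b h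
    exact ((counit_mk (.ob a) (.ob a)).symm.trans (congrArg C.counit.map h)).trans (counit_mk _ _)
  | succ n =>
    intro a b h
    refine Triple.ext ?_ ?_ ?_
    · exact (counit_wInc a).symm.trans ((congrArg C.counit.map h).trans (counit_wInc b))
    · exact (src_wInc a).symm.trans ((congrArg C.star.src h).trans (src_wInc b))
    · exact (tgt_wInc a).symm.trans ((congrArg C.star.tgt h).trans (tgt_wInc b))

theorem wInc_zero_surjective (C : OmegaCat.{u}) :
    Function.Surjective (C.wInc : C.WGen 0 → C.star.cell 0) := by
  intro q
  obtain ⟨x, h, rfl⟩ := StarCell.exists_rep q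
  cases x with
  | ob c => exact ⟨c, rfl⟩
  | comp j x y =>
    obtain ⟨-, -, hj, -⟩ := h.inv.1
    exact absurd hj (Nat.not_lt_zero _)

/-! #### Freeness -/

theorem TruncHom.map_bdTo {N : ℕ} {C D : OmegaCat.{u}} (F : TruncHom N C D) (ε : Bool) {j n : ℕ}
    (h : j ≤ n) (hn : n ≤ N) (x : C.cell n) :
    F.map j (h.trans hn) (C.bdTo ε h x) = D.bdTo ε h (F.map n hn x) := by
  induction n, h using Nat.le_induction with
  | base => rw [C.bdTo_self, D.bdTo_self]
  | succ n h ih =>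
    rw [C.bdTo_succ ε h, D.bdTo_succ ε h, ih (n.le_succ.trans hn)]
    cases ε
    · exact congrArg _ (F.map_src n hn x)
    · exact congrArg _ (F.map_tgt n hn x)

theorem TruncHom.map_composable {N : ℕ} {C D : OmegaCat.{u}} (F : TruncHom N C D) {j n : ℕ}
    (h : j ≤ n) (hn : n ≤ N) {x y : C.cell n} (c : C.tgtTo h x = C.srcTo h y) :
    D.tgtTo h (F.map n hn x) = D.srcTo h (F.map n hn y) :=
  (F.map_bdTo true h hn x).symm.trans ((congrArg _ c).trans (F.map_bdTo false h hn y))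

theorem TruncHom.map_mk_idn {N : ℕ} {C D : OmegaCat.{u}} (F : TruncHom N C.star D) {n : ℕ}
    (hn : n + 1 ≤ N) (x : Raw C n) (r : Raw.Rel (.idn x) (.idn x)) :
    F.map (n + 1) hn (StarCell.mk (.idn x) r) =
      D.idn (F.map n (n.le_succ.trans hn) (StarCell.mk x r.inv.1)) :=
  (congrArg _ (StarCell.idn_mk x r.inv.1).symm).trans (F.map_idn n hn _)

theorem TruncHom.map_mk_comp {N : ℕ} {C D : OmegaCat.{u}} (F : TruncHom N C.star D) {n j : ℕ}
    (hn : n ≤ N) (hj : j < n) (x y : Raw C n) (r : Raw.Rel (.comp j x y) (.comp j x y)) :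
    ∃ h, F.map n hn (StarCell.mk (.comp j x y) r) =
      D.comp j hj (F.map n hn (StarCell.mk x r.inv.1.1))
        (F.map n hn (StarCell.mk y r.inv.1.2.1)) h := by
  obtain ⟨rx, ry, _, rc⟩ := r.inv.1
  have c := (StarCell.composable_iff hj.le x y rx ry).mpr rc
  have c' := F.map_composable hj.le hn c
  exact ⟨c', (congrArg _ (StarCell.comp_mk hj x y rx ry c r).symm).trans
    (F.map_comp n hn j hj _ _ c c')⟩

theorem star_unique {C D : OmegaCat.{u}} {n : ℕ} (G G' : TruncHom (n + 1) C.star D)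
    (h : G.restrict = G'.restrict)
    (hg : ∀ a : C.WGen (n + 1), G.map (n + 1) le_rfl (C.wInc a) =
      G'.map (n + 1) le_rfl (C.wInc a)) : G = G' := by
  have hlow : ∀ k (hk : k ≤ n) (q : C.star.cell k),
      G.map k (hk.trans n.le_succ) q = G'.map k (hk.trans n.le_succ) q := fun k hk q =>
    congrFun (congrFun (congrFun (congrArg TruncHom.map h) k) hk) q
  have key : ∀ m (hm : m ≤ n + 1) (x : Raw C m) (r : Raw.Rel x x),
      G.map m hm (StarCell.mk x r) = G'.map m hm (StarCell.mk x r) := by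
    intro m hm x
    induction x with
    | ob c => intro r; exact hlow 0 (Nat.zero_le _) _
    | @gen k z x y _ _ =>
      intro r
      rcases hm.lt_or_eq with hm' | hm'
      · exact hlow _ (Nat.lt_succ_iff.mp hm') _
      · obtain rfl : k = n := Nat.succ.inj hm'
        have h1 := hg (Triple.ofRel r)
        rwa [wInc_ofRel] at h1
    | @idn k x ih =>
      intro r
      exact (G.map_mk_idn hm x r).trans
        ((congrArg D.idn (ih _ r.inv.1)).trans (G'.map_mk_idn hm x r).symm)
    | @comp k j x y ihx ihy =>
      intro r
      obtain ⟨-, -, hj, -⟩ := r.inv.1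
      obtain ⟨c, e⟩ := G.map_mk_comp hm hj x y r
      obtain ⟨c', e'⟩ := G'.map_mk_comp hm hj x y r
      rw [e, e']
      exact D.comp_congr _ (ihx hm _) (ihy hm _) _ _
  refine TruncHom.ext ?_
  funext m hm q
  obtain ⟨x, r, rfl⟩ := StarCell.exists_rep q
  exact key m hm x r

open Classical in
/-- The interpretation of expressions given by images of the generators. -/
noncomputable def interp {C D : OmegaCat.{u}} (o : C.cell 0 → D.cell 0)
    (g : ∀ k, C.Triple k → D.cell (k + 1)) (d : ∀ m, D.cell m) : ∀ {m : ℕ}, Raw C m → D.cell m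
  | _, .ob c => o c
  | _, .gen z x y =>
    if r : Raw.Rel (.gen z x y) (.gen z x y) then g _ (Triple.ofRel r) else d _
  | _, .idn x => D.idn (interp o g d x)
  | n, .comp j x y =>
    if h : ∃ hj : j < n, D.tgtTo hj.le (interp o g d x) = D.srcTo hj.le (interp o g d y) then
      D.comp j h.1 (interp o g d x) (interp o g d y) h.2
    else d _

theorem interp_comp {C D : OmegaCat.{u}} (o : C.cell 0 → D.cell 0)
    (g : ∀ k, C.Triple k → D.cell (k + 1)) (d : ∀ m, D.cell m) {n j : ℕ} (hj : j < n)
    (x y : Raw C n) (h : D.tgtTo hj.le (interp o g d x) = D.srcTo hj.le (interp o g d y)) :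
    interp o g d (.comp j x y) = D.comp j hj (interp o g d x) (interp o g d y) h := by
  have H : ∃ hj : j < n, D.tgtTo hj.le (interp o g d x) = D.srcTo hj.le (interp o g d y) := ⟨hj, h⟩
  rw [interp, dif_pos H]

theorem interp_gen {C D : OmegaCat.{u}} (o : C.cell 0 → D.cell 0)
    (g : ∀ k, C.Triple k → D.cell (k + 1)) (d : ∀ m, D.cell m) {n : ℕ} {z : C.cell (n + 1)}
    {x y : Raw C n} (r : Raw.Rel (.gen z x y) (.gen z x y)) :
    interp o g d (.gen z x y) = g n (Triple.ofRel r) := by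
  rw [interp, dif_pos r]

theorem star_exists {C D : OmegaCat.{u}} (n : ℕ) (F : TruncHom n C.star D)
    (g : C.WGen (n + 1) → D.cell (n + 1))
    (hs : ∀ a, D.src (g a) = F.map n le_rfl (C.star.src (C.wInc a)))
    (ht : ∀ a, D.tgt (g a) = F.map n le_rfl (C.star.tgt (C.wInc a))) :
    ∃ G : TruncHom (n + 1) C.star D,
      G.restrict = F ∧ ∀ a, G.map (n + 1) le_rfl (C.wInc a) = g a := by
  by_cases hD : Nonempty (D.cell 0)
  swap
  · have hE : ∀ k, C.star.cell k → False := fun k q =>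
      hD ⟨F.map 0 (Nat.zero_le _) (C.star.bdTo false (Nat.zero_le k) q)⟩
    refine ⟨⟨fun k _ q => (hE k q).elim, fun k _ q => (hE _ q).elim, fun k _ q => (hE _ q).elim,
      fun k _ q => (hE _ q).elim, fun k _ _ _ q => (hE _ q).elim⟩, ?_, fun a => (hE _ (C.wInc a)).elim⟩
    refine TruncHom.ext ?_
    funext k hk q
    exact (hE k q).elim
  obtain ⟨d0⟩ := hD
  let d : ∀ m, D.cell m := fun m => D.idTo (Nat.zero_le m) d0
  -- images of the generators of dimension at most `n + 1`
  obtain ⟨g', hlow, htop⟩ : ∃ g' : ∀ k, C.Triple k → D.cell (k + 1),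
      (∀ k (hk : k + 1 ≤ n) (t : C.Triple k),
        g' k t = F.map (k + 1) hk (C.wInc (n := k + 1) t)) ∧
      (∀ t : C.Triple n, g' n t = g t) := by
    classical
    refine ⟨fun k t => if hk : k + 1 ≤ n then F.map (k + 1) hk (C.wInc (n := k + 1) t) else
      if e : k = n then Eq.rec (motive := fun m _ => D.cell (m + 1))
        (g (Eq.rec (motive := fun m _ => C.Triple m) t e)) e.symm else d _, ?_, ?_⟩
    · intro k hk t; simp only [dif_pos hk]
    · intro t
      have : ¬ n + 1 ≤ n := by omega
      simp only [dif_neg this, dif_pos]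
  let Ψ : ∀ m, Raw C m → D.cell m := fun m =>
    interp (fun c => F.map 0 (Nat.zero_le n) (C.wInc (n := 0) c)) g' d
  have hcomp : ∀ (n j : ℕ) (hj : j < n) (x y : Raw C n) (h),
      Ψ n (.comp j x y) = D.comp j hj (Ψ n x) (Ψ n y) h := fun n j hj x y h =>
    interp_comp _ _ _ hj x y h
  have hidn : ∀ (n : ℕ) (x : Raw C n), Ψ (n + 1) (.idn x) = D.idn (Ψ n x) := fun n x => rfl
  have hgen : ∀ {k : ℕ} {z : C.cell (k + 1)} {x y : Raw C k}
      (r : Raw.Rel (.gen z x y) (.gen z x y)), Ψ (k + 1) (.gen z x y) = g' k (Triple.ofRel r) :=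
    fun r => interp_gen _ _ _ r
  have hF : ∀ m (hm : m ≤ n) (x : Raw C m) (r : Raw.Rel x x),
      Ψ m x = F.map m hm (StarCell.mk x r) := by
    intro m hm x
    induction x with
    | ob c => intro r; rfl
    | @gen k z x y _ _ =>
      intro r
      rw [hgen r, hlow k hm, wInc_ofRel]
    | @idn k x ih =>
      intro r
      exact (congrArg D.idn (ih _ r.inv.1)).trans (F.map_mk_idn hm x r).symm
    | @comp k j x y ihx ihy =>
      intro r
      obtain ⟨rx, ry, hj, -⟩ := r.inv.1
      obtain ⟨c, e⟩ := F.map_mk_comp hm hj x y r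
      have c' := c
      rw [← ihx hm, ← ihy hm] at c'
      rw [e, hcomp k j hj x y c']
      exact D.comp_congr _ (ihx hm _) (ihy hm _) _ _
  have snd : ∀ {m : ℕ} {x y : Raw C m}, Raw.Rel x y → m ≤ n + 1 →
      Ψ m x = Ψ m y ∧ Raw.BdC Ψ x ∧ Raw.BdC Ψ y := by
    intro m x y r hm
    refine Raw.sound (Ψ := Ψ) (fun m => m ≤ n + 1) (fun i j hij hj => hij.trans hj) ?_ ?_
      hidn hcomp r hm
    · intro k z x y hk rx ry q hs' ht' ε
      have hk' : k ≤ n := Nat.succ_le_succ_iff.mp hk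
      have r : Raw.Rel (.gen z x y) (.gen z x y) := .gen rx ry q hs' ht'
      rw [hgen r]
      have key : D.src (g' k (Triple.ofRel r)) =
            F.map k hk' (C.star.src (C.wInc (n := k + 1) (Triple.ofRel r))) ∧
          D.tgt (g' k (Triple.ofRel r)) =
            F.map k hk' (C.star.tgt (C.wInc (n := k + 1) (Triple.ofRel r))) := by
        rcases hk'.lt_or_eq with hk'' | rfl
        · rw [hlow k hk'']
          exact ⟨(F.map_src k hk'' _).symm, (F.map_tgt k hk'' _).symm⟩
        · rw [htop]
          exact ⟨hs _, ht _⟩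
      cases ε
      · refine key.1.trans ?_
        rw [src_wInc]; exact (hF k hk' x rx).symm
      · refine key.2.trans ?_
        rw [tgt_wInc]; exact (hF k hk' y ry).symm
    · intro k z x x' y y' hk rx ry q hs' ht'
      have r : Raw.Rel (.gen z x y) (.gen z x' y') := .gen rx ry q hs' ht'
      rw [hgen r.left, hgen r.right, ofRel_congr r.left r.right rx ry]
  have hmk : ∀ {m : ℕ} (_ : m ≤ n + 1) (x : Raw C m) (r : Raw.Rel x x),
      Ψ m (StarCell.rep (StarCell.mk x r)) = Ψ m x := fun hm x r =>
    (snd (StarCell.rep_mk x r) hm).1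
  have hbd : ∀ (ε : Bool) {k : ℕ} (_ : k + 1 ≤ n + 1) (x : Raw C (k + 1)) (_ : Raw.Rel x x),
      Ψ k (Raw.bd ε x : Raw C k) = D.bd ε (Ψ (k + 1) x) := by
    intro ε k hk x r
    have h := (snd r hk).2.1 ε k k.le_succ
    rwa [Raw.bdTo_succ ε le_rfl, Raw.bdTo_self, D.bdTo_succ ε le_rfl, D.bdTo_self] at h
  refine ⟨⟨fun k _ q => Ψ k (StarCell.rep q), fun k hk q => ?_, fun k hk q => ?_,
    fun k hk q => ?_, fun k hk j hj p q h h' => ?_⟩, ?_, fun a => ?_⟩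
  · exact (hmk (k.le_succ.trans hk) _ _).trans (hbd false hk _ (StarCell.rel_rep q))
  · exact (hmk (k.le_succ.trans hk) _ _).trans (hbd true hk _ (StarCell.rel_rep q))
  · exact hmk hk _ _
  · exact (hmk hk _ _).trans (hcomp k j hj _ _ h')
  · refine TruncHom.ext ?_
    funext k hk q
    exact (hF k hk _ (StarCell.rel_rep q)).trans (congrArg _ (StarCell.mk_rep q))
  · refine (hmk le_rfl _ (Triple.rel a)).trans ?_
    exact (hgen (Triple.rel a)).trans ((congrArg (g' n) (ofRel_rel a)).trans (htop a))

/-- The polygraph `W(C)` of an ω-category `C`. -/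
noncomputable def polygraph (C : OmegaCat.{u}) : Polygraph.{u} where
  free := C.star
  gen := C.WGen
  inc := C.wInc
  inc_injective := C.wInc_injective
  inc_zero_surjective := C.wInc_zero_surjective
  universal n D F g hs ht := by
    obtain ⟨G, h, hg⟩ := star_exists n F g hs ht
    exact ⟨G, ⟨h, hg⟩, fun G' ⟨h', hg'⟩ =>
      star_unique _ _ (h'.trans h.symm) fun a => (hg' a).trans (hg a).symm⟩

/-! #### Functoriality -/

/-- The ω-functor induced on free ω-categories by an ω-functor. -/
noncomputable def starMap {C D : OmegaCat.{u}} (f : C ⟶ D) : C.star ⟶ D.star where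
  map q := StarCell.mk (Raw.map f (StarCell.rep q)) ((StarCell.rel_rep q).map f)
  map_src q := by
    refine Eq.trans ?_ (StarCell.bd_mk false _ _).symm
    refine StarCell.mk_eq_mk.mpr (((StarCell.rep_mk _ _).map f).trans ?_)
    rw [Raw.map_bd]; exact ((StarCell.rel_rep q).map f).bd false
  map_tgt q := by
    refine Eq.trans ?_ (StarCell.bd_mk true _ _).symm
    refine StarCell.mk_eq_mk.mpr (((StarCell.rep_mk _ _).map f).trans ?_)
    rw [Raw.map_bd]; exact ((StarCell.rel_rep q).map f).bd true
  map_idn q := by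
    refine Eq.trans ?_ (StarCell.idn_mk _ _).symm
    exact StarCell.mk_eq_mk.mpr ((StarCell.rep_mk _ _).map f)
  map_comp hj p q h h' := by
    refine Eq.trans ?_ (StarCell.comp_mk hj _ _ _ _ h' ((StarCell.rel_comp hj p q h).map f)).symm
    exact StarCell.mk_eq_mk.mpr ((StarCell.rep_mk _ _).map f)

theorem starMap_mk {C D : OmegaCat.{u}} (f : C ⟶ D) {n : ℕ} (x : Raw C n) (r : Raw.Rel x x) :
    (starMap f).map (StarCell.mk x r) = StarCell.mk (Raw.map f x) (r.map f) :=
  StarCell.mk_eq_mk.mpr ((StarCell.rep_mk _ _).map f)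

theorem counit_naturality {C D : OmegaCat.{u}} (f : C ⟶ D) {n : ℕ} (q : C.star.cell n) :
    D.counit.map ((starMap f).map q) = f.map (C.counit.map q) :=
  (counit_mk _ _).trans (Raw.eval_map f _ (StarCell.rel_rep q))

/-- The action of an ω-functor `f` on the triples: `(z, x, y)` is sent to `(f z, f x, f y)`. -/
noncomputable def tripleMap {C D : OmegaCat.{u}} (f : C ⟶ D) {n : ℕ} (t : C.Triple n) :
    D.Triple n where
  z := f.map t.z
  x := (starMap f).map t.x
  y := (starMap f).map t.y
  parallel := by
    obtain ⟨z, x, y, p, -, -⟩ := t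
    cases n with
    | zero => trivial
    | succ n =>
      exact ⟨((starMap f).map_src x).symm.trans ((congrArg _ p.1).trans ((starMap f).map_src y)),
        ((starMap f).map_tgt x).symm.trans ((congrArg _ p.2).trans ((starMap f).map_tgt y))⟩
  src_z := by rw [counit_naturality, ← t.src_z]; exact (f.map_src _).symm
  tgt_z := by rw [counit_naturality, ← t.tgt_z]; exact (f.map_tgt _).symm

/-- The action of an ω-functor on generators. -/
noncomputable def wGenMap {C D : OmegaCat.{u}} (f : C ⟶ D) : ∀ {n : ℕ}, C.WGen n → D.WGen n
  | 0, c => f.map (n := 0) c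
  | _ + 1, t => tripleMap f t

/-- The morphism of polygraphs induced by an ω-functor. -/
noncomputable def polygraphMap {C D : OmegaCat.{u}} (f : C ⟶ D) : C.polygraph ⟶ D.polygraph where
  free := starMap f
  gen := wGenMap f
  free_inc {n} a := by
    cases n with
    | zero => exact starMap_mk f _ _
    | succ n =>
      refine (starMap_mk f _ (Triple.rel a)).trans (StarCell.mk_eq_mk.mpr ?_)
      obtain ⟨rx, ry, q, hs, ht⟩ := ((Triple.rel a).map f).inv.1
      exact .gen (StarCell.rep_mk _ _).symm (StarCell.rep_mk _ _).symm q hs ht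

theorem starMap_id (C : OmegaCat.{u}) : starMap (𝟙 C) = 𝟙 C.star := by
  refine Hom.ext ?_
  funext n q
  refine Eq.trans ?_ (StarCell.mk_rep q)
  exact StarCell.mk_eq_mk.mpr (by rw [Raw.map_id]; exact StarCell.rel_rep q)

theorem starMap_comp {C D E : OmegaCat.{u}} (f : C ⟶ D) (g : D ⟶ E) :
    starMap (f ≫ g) = starMap f ≫ starMap g := by
  refine Hom.ext ?_
  funext n q
  refine Eq.trans ?_ (starMap_mk g _ _).symm
  exact StarCell.mk_eq_mk.mpr (by
    rw [Raw.map_map]; exact ((StarCell.rel_rep q).map f).map g)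

end OmegaCat

/-- A morphism of polygraphs is determined by its underlying ω-functor. -/
theorem Polygraph.hom_ext_free {P Q : Polygraph.{u}} {f g : P ⟶ Q}
    (h : f.free = g.free) : f = g := by
  refine Polygraph.Hom.ext h ?_
  funext n a
  have e : f.free.map (P.inc a) = g.free.map (P.inc a) := by rw [h]
  exact Q.inc_injective n ((f.free_inc a).symm.trans (e.trans (g.free_inc a)))

/-- The functor from ω-categories to polygraphs. -/
noncomputable def polyW : OmegaCat.{u} ⥤ Polygraph.{u} where
  obj C := C.polygraph
  map f := OmegaCat.polygraphMap f
  map_id C := Polygraph.hom_ext_free (OmegaCat.starMap_id C)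
  map_comp f g := Polygraph.hom_ext_free (OmegaCat.starMap_comp f g)

/-! The isomorphism is the counit `ε : W(C)* → C`, restricted to those generators of `W(C)` that
survive in `G(W(C))`. A positive-dimensional generator is a triple `(z, x, y)`, where `x` and `y`
are arbitrary parallel cells of `W(C)*` lying over the source and the target of `z`. In general `z`
has many such decorations, since a cell of `C` can be the value of many formal composites. Belonging
to `G(W(C))` removes this freedom: `x` and `y` must themselves be globular generators, so their own
boundaries are constrained in the same way, down to dimension `0`, where generators are just the
`0`-cells of `C`. Hence every cell of `C` should have exactly one globular lift, `[z] = z` in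
dimension `0` and `[z] = (z, [s z], [t z])` above.

Two inductions on the dimension make this precise.

Uniqueness (`globCounit_injective`): if two globular generators have the same value `z`, their
sources have the same value `s z` and their targets the same value `t z`. By induction the
boundaries agree, and a triple is determined by its value and its boundaries.

Existence (`globCounit_surjective`): lift `s z` and `t z` by induction and form the triple. The one
point that needs an argument is that the two lifts are parallel in `W(C)*`, whereas a priori only
their values in `C` are parallel. This is `parallel_of_globCounit`: the boundaries of the lifts are
globular generators one dimension lower, with equal values, so uniqueness in that dimension makes
them equal. Uniqueness is therefore established in all dimensions before existence.

Naturality in `C` is the naturality of `ε`, restricted to generators. What enters about `W(C)*` is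
that `ε` is a natural ω-functor and that the generator `(z, x, y)` has source `x`, target `y` and
value `z` (`src_wInc`, `tgt_wInc`, `counit_wInc`). -/

/-! ### Isomorphisms of globular sets -/

namespace GlobularSet

/-- A globular map that is bijective in every dimension is an isomorphism. -/
noncomputable def isoOfBijective {X Y : GlobularSet.{u}} (f : X ⟶ Y)
    (h : ∀ n, Function.Bijective (Hom.map f : X.cell n → Y.cell n)) : X ≅ Y where
  hom := f
  inv :=
    { map := fun {n} => (Equiv.ofBijective _ (h n)).symm
      map_src := fun {n} y => by
        -- As `f` is injective, compatibility of the inverse with sources may be tested after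
        -- applying `f`. Both sides then become the source of `y`: one because `f` undoes the
        -- inverse in dimension `n`, the other because `f` commutes with sources and undoes the
        -- inverse in dimension `n + 1`.
        apply (h n).1
        rw [Hom.map_src f]
        refine ((Equiv.ofBijective _ (h n)).apply_symm_apply _).trans (congrArg Y.src ?_)
        exact ((Equiv.ofBijective _ (h (n + 1))).apply_symm_apply _).symm
      map_tgt := fun {n} y => by
        apply (h n).1
        rw [Hom.map_tgt f]
        refine ((Equiv.ofBijective _ (h n)).apply_symm_apply _).trans (congrArg Y.tgt ?_)
        exact ((Equiv.ofBijective _ (h (n + 1))).apply_symm_apply _).symm }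
  hom_inv_id := Hom.ext (funext fun n => funext fun x =>
    (Equiv.ofBijective _ (h n)).symm_apply_apply x)
  inv_hom_id := Hom.ext (funext fun n => funext fun y =>
    (Equiv.ofBijective _ (h n)).apply_symm_apply y)

end GlobularSet

/-! ### The comparison map from globular generators to cells -/

namespace OmegaCat

variable (C : OmegaCat.{u})

/-- The counit restricted to the hereditarily globular generators of `W(C)`. -/
noncomputable def globCounit : C.polygraph.glob ⟶ C.toGlobularSet where
  map a := C.counit.map (C.polygraph.inc a.1)
  -- The source of a globular generator is picked by choice, so the only handle on it is the
  -- equation `inc_globSrc`: its inclusion is the source in the free ω-category. The counit, being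
  -- an ω-functor, then carries it to the source in `C`.
  map_src a := (congrArg C.counit.map (C.polygraph.inc_globSrc a)).trans (C.counit.map_src _)
  map_tgt a := (congrArg C.counit.map (C.polygraph.inc_globTgt a)).trans (C.counit.map_tgt _)

/-- The statement typechecks because the `0`-generators of `W(C)` are by definition the `0`-cells of
`C`. Together with the next lemma it expresses the value of a globular generator through the raw
data of the generator, which is what extensionality of triples needs. -/
theorem globCounit_zero (a : C.polygraph.glob.cell 0) : C.globCounit.map a = a.1 :=
  counit_mk _ _

theorem globCounit_succ {n : ℕ} (a : C.polygraph.glob.cell (n + 1)) :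
    C.globCounit.map a = Triple.z a.1 :=
  counit_wInc a.1

/-! ### Existence and uniqueness of globular lifts -/

/-- The value of a globular generator determines the values of its source and target, which are
again globular generators; by induction it determines the source and target themselves, hence the
whole triple. Restricting to globular generators is essential: the counit identifies, for instance,
a formal identity on `q` with the generator whose value is the identity of the value of `q` and
whose two boundaries are `q`. -/
theorem globCounit_injective (n : ℕ) :
    Function.Injective (C.globCounit.map : C.polygraph.glob.cell n → C.cell n) := by
  induction n with
  | zero =>
    intro a b h
    exact Subtype.ext ((C.globCounit_zero a).symm.trans (h.trans (C.globCounit_zero b)))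
  | succ n ih =>
    intro a b h
    -- Both sources have as value the source of the common value of `a` and `b`, so the induction
    -- hypothesis applies to them. Targets are treated in the same way.
    have hs : C.polygraph.globSrc a = C.polygraph.globSrc b :=
      ih ((C.globCounit.map_src a).trans ((congrArg C.src h).trans (C.globCounit.map_src b).symm))
    have ht : C.polygraph.globTgt a = C.polygraph.globTgt b :=
      ih ((C.globCounit.map_tgt a).trans ((congrArg C.tgt h).trans (C.globCounit.map_tgt b).symm))
    -- Being globular is a proposition, so it suffices to compare triples. The first components are
    -- the values, equal by `h`.
    refine Subtype.ext (Triple.ext ?_ ?_ ?_)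
    · exact (C.globCounit_succ a).symm.trans (h.trans (C.globCounit_succ b))
    -- The component `x` of a triple is a cell of the free ω-category, while `hs` equates
    -- generators. The two are linked by reading `x` as the source of the included triple, which is
    -- the inclusion of its globular source.
    · refine (src_wInc a.1).symm.trans (Eq.trans ?_ (src_wInc b.1))
      exact (C.polygraph.inc_globSrc a).symm.trans
        ((congrArg (fun c => C.polygraph.inc c.1) hs).trans (C.polygraph.inc_globSrc b))
    · refine (tgt_wInc a.1).symm.trans (Eq.trans ?_ (tgt_wInc b.1))
      exact (C.polygraph.inc_globTgt a).symm.trans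
        ((congrArg (fun c => C.polygraph.inc c.1) ht).trans (C.polygraph.inc_globTgt b))

/-- Hereditarily globular generators are parallel as soon as their values in `C` are. -/
theorem parallel_of_globCounit {n : ℕ} (a b : C.polygraph.glob.cell n)
    (h : C.Parallel (C.globCounit.map a) (C.globCounit.map b)) :
    C.star.Parallel (C.polygraph.inc a.1) (C.polygraph.inc b.1) := by
  cases n with
  | zero => trivial
  | succ n =>
    -- Here `a` and `b` have dimension `n + 1`, and injectivity is used one dimension lower, on
    -- their boundaries. The values of `a` and `b` themselves may differ; only the boundaries of
    -- these values are known to agree.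
    have hs : C.polygraph.globSrc a = C.polygraph.globSrc b := C.globCounit_injective n
      ((C.globCounit.map_src a).trans (h.1.trans (C.globCounit.map_src b).symm))
    have ht : C.polygraph.globTgt a = C.polygraph.globTgt b := C.globCounit_injective n
      ((C.globCounit.map_tgt a).trans (h.2.trans (C.globCounit.map_tgt b).symm))
    exact ⟨(C.polygraph.inc_globSrc a).symm.trans
        ((congrArg (fun c => C.polygraph.inc c.1) hs).trans (C.polygraph.inc_globSrc b)),
      (C.polygraph.inc_globTgt a).symm.trans
        ((congrArg (fun c => C.polygraph.inc c.1) ht).trans (C.polygraph.inc_globTgt b))⟩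

/-- These are the globular identities in the form required by `parallel_of_globCounit`, when lifts
of the two boundaries of `z` are to be assembled into a triple over `z`. -/
theorem parallel_src_tgt {n : ℕ} (z : C.cell (n + 1)) : C.Parallel (C.src z) (C.tgt z) := by
  cases n with
  | zero => trivial
  | succ n => exact ⟨C.src_src z, C.tgt_src z⟩

/-- The lift of `z` is built from lifts of its source and target. Nothing has to be arranged in
choosing these two lifts: they are automatically parallel, since globular lifts are unique in lower
dimension. -/
theorem globCounit_surjective (n : ℕ) :
    Function.Surjective (C.globCounit.map : C.polygraph.glob.cell n → C.cell n) := by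
  induction n with
  -- In dimension `0` a cell of `C` is already a generator, and being globular is no condition.
  | zero => exact fun z => ⟨⟨z, trivial⟩, C.globCounit_zero _⟩
  | succ n ih =>
    intro z
    obtain ⟨a, ha⟩ := ih (C.src z)
    obtain ⟨b, hb⟩ := ih (C.tgt z)
    have p : C.star.Parallel (C.polygraph.inc a.1) (C.polygraph.inc b.1) :=
      C.parallel_of_globCounit a b (by rw [ha, hb]; exact C.parallel_src_tgt z)
    -- The equations `ha` and `hb` are exactly the typing conditions on a triple, since the
    -- comparison map is by definition the counit applied to the included generator.
    let t : C.Triple n := ⟨z, C.polygraph.inc a.1, C.polygraph.inc b.1, p, ha.symm, hb.symm⟩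
    -- The triple is globular because its source and target are the inclusions of `a` and `b`, which
    -- therefore serve as the witnesses.
    exact ⟨⟨t, ⟨a.1, a.2, (src_wInc t).symm⟩, ⟨b.1, b.2, (tgt_wInc t).symm⟩⟩, counit_wInc t⟩

theorem globCounit_bijective (n : ℕ) :
    Function.Bijective (C.globCounit.map : C.polygraph.glob.cell n → C.cell n) :=
  ⟨C.globCounit_injective n, C.globCounit_surjective n⟩

/-! ### Naturality and the isomorphism -/

-- A morphism of polygraphs acts compatibly on generators and on free cells (`free_inc`), so the
-- square for generators is the restriction of the naturality square of the counit.
variable {C} in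
theorem globCounit_naturality {D : OmegaCat.{u}} (f : C ⟶ D) {n : ℕ}
    (a : C.polygraph.glob.cell n) :
    D.globCounit.map ((polygraphMap f).glob.map a) = f.map (C.globCounit.map a) :=
  (congrArg D.counit.map ((polygraphMap f).free_inc a.1).symm).trans (counit_naturality f _)

end OmegaCat

theorem lemma1 : Nonempty (polyW.{u} ⋙ globG.{u} ≅ forgetU.{u}) :=
  ⟨NatIso.ofComponents
    -- The forward map of each component is the counit on globular generators itself, so the
    -- naturality condition below involves no inverse.
    (fun C => GlobularSet.isoOfBijective C.globCounit C.globCounit_bijective)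
    (fun f => GlobularSet.Hom.ext (funext fun _ => funext fun a =>
      OmegaCat.globCounit_naturality f a))⟩
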